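/- Let $\Omega\subset\mathbb{R}^n$ be a bounded domain with Lipschitz boundary, $T>0$, $\Omega_T=\Omega\times(0,T)$, $m\ge 1$ a real number, and let $p:\overline\Omega\to(1,\infty)$ be log-Hölder continuous with $1<p^-\le p(x)\le p^+<\infty$. Let $D$ denote the weak gradient in $x$, and $$\mathcal V(\Omega)=\{v\in L^2(\Omega): |Dv|^{p(x)}\in L^1(\Omega)\},\qquad \|v\|_{\mathcal V}=\|v\|_{L^2(\Omega)}+\|Dv\|_{L^{p(\cdot)}(\Omega)}$$ (with the Luxemburg norm of $L^{p(\cdot)}$), let $\mathcal V_0(\Omega)$ be the closure of $C_0^\infty(\Omega)$ in $\mathcal V(\Omega)$, and let $$\mathcal U(\Omega_T)=\{u:(0,T)\to\mathcal V(\Omega):\ u\in L^2(\Omega_T),\ |Du|^{p(x)}\in L^1(\Omega_T)\},\qquad \|u\|_{\mathcal U}=\|u\|_{L^2(\Omega_T)}+\|Du\|_{L^{p(\cdot)}(\Omega_T)},$$ with dual space $\mathcal U'(\Omega_T)$. Consider the problem $$\partial_t u=u^m\,\mathrm{div}\big(|Du|^{p(x)-2}Du\big)\ \text{in }\Omega_T,\qquad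 u=0\ \text{on }\partial\Omega\times(0,T),\qquad u(\cdot,0)=u_0\ \text{in }\Omega.$$ A weak solution is a function $u\ge 0$ on $\Omega_T$ such that $u\in\mathcal U(\Omega_T)\cap L^\infty(\Omega_T)$, $\partial_t u\in\mathcal U'(\Omega_T)\cap L^2(\Omega_T)$, $$\iint_{\Omega_T}\partial_t u\,\varphi\,dx\,dt+\iint_{\Omega_T}|Du|^{p(x)-2}Du\cdot D(u^m\varphi)\,dx\,dt=0\qquad\text{for every }\varphi\in C_0^1(\Omega_T),$$ and the boundary and initial conditions hold in the sense of trace, that is, $u(t)\in\mathcal V_0(\Omega)$ for a.e. $t\in(0,T)$, and the representative of $u$ in $C([0,T];L^2(\Omega))$ takes the value $u_0$ at $t=0$. For $f:\Omega\to[0,\infty)$ put $F=\{x\in\Omega: f(x)>0\}$ and let $\operatorname{supp} f$ be the closure in $\Omega$ of $$\Big\{x\in F:\ \lim_{r\to0}\frac{|F\cap B_r(x)|}{|B_r(x)|}\ \text{exists and is}\ >0\Big\}.$$ Let $u_0\ge0$ with $\operatorname{supp}u_0\subsetneqq\Omega$, and let $u$ be any weak solution of the problem. Then $\operatorname{supp}u(t)\subset\operatorname{supp}u_0$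 for a.e. $t\in(0,T]$. -/

import Mathlib

open MeasureTheory Set Filter Topology
open scoped ENNReal NNReal ContDiff

namespace PxParabolic

noncomputable section

/-- The Euclidean space `ℝⁿ`. -/
abbrev E (n : ℕ) : Type := EuclideanSpace ℝ (Fin n)

/-! ### The domain and the exponent -/

/-- Near each of its boundary points, `Ω` is, in suitable orthogonal coordinates, the open region
above the graph of a Lipschitz function. Here `ν` is the vertical unit direction, and
`x - ⟪ν, x⟫ ν` is the projection of `x` to the hyperplane orthogonal to `ν`. -/
def HasLipschitzBoundary {n : ℕ} (Ω : Set (E n)) : Prop :=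
  ∀ x₀ ∈ frontier Ω, ∃ (ν : E n) (γ : E n → ℝ) (K : ℝ≥0) (r : ℝ),
    ‖ν‖ = 1 ∧ LipschitzWith K γ ∧ 0 < r ∧
    ∀ x ∈ Metric.ball x₀ r, x ∈ Ω ↔ γ (x - inner ℝ ν x • ν) < inner ℝ ν x

/-- A bounded domain (open connected nonempty set) with Lipschitz boundary. -/
structure IsBoundedLipschitzDomain {n : ℕ} (Ω : Set (E n)) : Prop where
  isOpen : IsOpen Ω
  isConnected : IsConnected Ω
  isBounded : Bornology.IsBounded Ω
  lipschitz : HasLipschitzBoundary Ω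

/-- `p` is a log-Hölder continuous exponent on `closure Ω` with `1 < p⁻ ≤ p(x) ≤ p⁺ < ∞`. -/
structure IsLogHolderExponent {n : ℕ} (Ω : Set (E n)) (p : E n → ℝ) : Prop where
  logHolder : ∃ C : ℝ, ∀ x ∈ closure Ω, ∀ y ∈ closure Ω,
    |p x - p y| ≤ C / Real.log (Real.exp 1 + 1 / dist x y)
  bounds : ∃ pmin pmax : ℝ, 1 < pmin ∧ ∀ x ∈ closure Ω, pmin ≤ p x ∧ p x ≤ pmax

/-! ### Variable exponent norm -/

/-- The modular `∫ |f|^{q(x)} dμ`. -/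
def modular {X F : Type*} [MeasurableSpace X] [NormedAddCommGroup F]
    (μ : Measure X) (q : X → ℝ) (f : X → F) : ℝ≥0∞ :=
  ∫⁻ x, ‖f x‖ₑ ^ q x ∂μ

/-- The Luxemburg norm `inf {α > 0 | ϱ_q(f / α) ≤ 1}` (equal to `∞` if there is no such `α`). -/
def luxNorm {X F : Type*} [MeasurableSpace X] [NormedAddCommGroup F] [NormedSpace ℝ F]
    (μ : Measure X) (q : X → ℝ) (f : X → F) : ℝ≥0∞ :=
  ⨅ (α : ℝ) (_ : 0 < α ∧ modular μ q (fun x => α⁻¹ • f x) ≤ 1), ENNReal.ofReal α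

/-! ### Weak derivatives and function spaces -/

/-- `φ` is of class `C^k` with compact support in the set `U`. -/
def IsTest {X : Type*} [NormedAddCommGroup X] [NormedSpace ℝ X]
    (k : WithTop ℕ∞) (U : Set X) (φ : X → ℝ) : Prop :=
  ContDiff ℝ k φ ∧ HasCompactSupport φ ∧ tsupport φ ⊆ U

/-- `g` is the weak gradient of `v` on `Ω`. -/
def IsWeakGradient {n : ℕ} (Ω : Set (E n)) (v : E n → ℝ) (g : E n → E n) : Prop :=
  LocallyIntegrableOn v Ω ∧ LocallyIntegrableOn g Ω ∧
  ∀ φ : E n → ℝ, IsTest ∞ Ω φ →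
    ∫ x in Ω, v x • gradient φ x = -∫ x in Ω, φ x • g x

/-- `v ∈ 𝒱(Ω)`, with weak gradient `g`: `v ∈ L²(Ω)` and `|g|^{p(x)} ∈ L¹(Ω)`. -/
def MemV {n : ℕ} (Ω : Set (E n)) (p : E n → ℝ) (v : E n → ℝ) (g : E n → E n) : Prop :=
  MemLp v 2 (volume.restrict Ω) ∧ IsWeakGradient Ω v g ∧
  Integrable (fun x => ‖g x‖ ^ p x) (volume.restrict Ω)

/-- `v ∈ 𝒱₀(Ω)`, with weak gradient `g`: `v` is in the closure of `C₀^∞(Ω)` in `𝒱(Ω)` for the norm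
`‖v‖₂ + ‖Dv‖_{p(·)}`. -/
def MemVZero {n : ℕ} (Ω : Set (E n)) (p : E n → ℝ) (v : E n → ℝ) (g : E n → E n) : Prop :=
  MemV Ω p v g ∧ ∀ ε : ℝ≥0∞, 0 < ε → ∃ φ : E n → ℝ, IsTest ∞ Ω φ ∧
    eLpNorm (fun x => v x - φ x) 2 (volume.restrict Ω)
      + luxNorm (volume.restrict Ω) p (fun x => g x - gradient φ x) < ε

/-- The cylinder `Ω_T = Ω × (0,T)`. -/
def cylinder {n : ℕ} (Ω : Set (E n)) (T : ℝ) : Set (E n × ℝ) := Ω ×ˢ Ioo 0 T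

/-- `G` is the weak gradient of `f` in the space variable on `Ω_T`. -/
def IsSpatialGradient {n : ℕ} (Ω : Set (E n)) (T : ℝ) (f : E n × ℝ → ℝ) (G : E n × ℝ → E n) :
    Prop :=
  AEStronglyMeasurable G (volume.restrict (cylinder Ω T)) ∧
  ∀ᵐ t ∂(volume.restrict (Ioo 0 T)),
    IsWeakGradient Ω (fun x => f (x, t)) (fun x => G (x, t))

/-- `w` is the weak derivative of `f` in the time variable on `Ω_T`. -/
def IsWeakTimeDeriv {n : ℕ} (Ω : Set (E n)) (T : ℝ) (f w : E n × ℝ → ℝ) : Prop :=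
  LocallyIntegrableOn f (cylinder Ω T) ∧ LocallyIntegrableOn w (cylinder Ω T) ∧
  ∀ φ : E n × ℝ → ℝ, IsTest ∞ (cylinder Ω T) φ →
    ∫ z in cylinder Ω T, f z * deriv (fun s => φ (z.1, s)) z.2
      = -∫ z in cylinder Ω T, w z * φ z

/-- `u ∈ 𝒰(Ω_T)`, with spatial weak gradient `G`: `u ∈ L²(Ω_T)`, `u(t) ∈ 𝒱(Ω)` for a.e. `t`, and
`|G|^{p(x)} ∈ L¹(Ω_T)`. -/
def MemU {n : ℕ} (Ω : Set (E n)) (T : ℝ) (p : E n → ℝ) (u : E n × ℝ → ℝ) (G : E n × ℝ → E n) :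
    Prop :=
  MemLp u 2 (volume.restrict (cylinder Ω T)) ∧ IsSpatialGradient Ω T u G ∧
  (∀ᵐ t ∂(volume.restrict (Ioo 0 T)), MemV Ω p (fun x => u (x, t)) (fun x => G (x, t))) ∧
  Integrable (fun z => ‖G z‖ ^ p z.1) (volume.restrict (cylinder Ω T))

/-- `φ ↦ ∬ w φ` is a bounded linear functional on `𝒰(Ω_T)`, for its norm
`‖φ‖₂ + ‖Dφ‖_{p(·)}`. -/
def MemUDual {n : ℕ} (Ω : Set (E n)) (T : ℝ) (p : E n → ℝ) (w : E n × ℝ → ℝ) : Prop :=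
  ∃ C : ℝ≥0, ∀ (φ : E n × ℝ → ℝ) (Φ : E n × ℝ → E n), MemU Ω T p φ Φ →
    Integrable (fun z => w z * φ z) (volume.restrict (cylinder Ω T)) ∧
    ‖∫ z in cylinder Ω T, w z * φ z‖ₑ ≤
      C * (eLpNorm φ 2 (volume.restrict (cylinder Ω T))
        + luxNorm (volume.restrict (cylinder Ω T)) (fun z => p z.1) Φ)

/-! ### Weak solutions -/

/-- `u(·,0) = u₀` in the sense of trace: `u` has a representative in `C([0,T]; L²(Ω))` whose value
at `t = 0` is `u₀`. -/
def HasInitialTrace {n : ℕ} (Ω : Set (E n)) (T : ℝ) (u : E n × ℝ → ℝ) (u₀ : E n → ℝ) : Prop :=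
  ∃ U : ℝ → Lp ℝ 2 (volume.restrict Ω), ContinuousOn U (Icc 0 T) ∧
    (∀ᵐ t ∂(volume.restrict (Ioo 0 T)), U t =ᵐ[volume.restrict Ω] fun x => u (x, t)) ∧
    U 0 =ᵐ[volume.restrict Ω] u₀

/-- `u` is a nonnegative weak solution of `∂ₜu = u^m div(|Du|^{p(x)-2} Du)` in `Ω_T`, `u = 0` on
`∂Ω × (0,T)`, `u(·,0) = u₀`; its weak derivatives are `Du = G` and `∂ₜu = w`. -/
structure IsWeakSolutionWith {n : ℕ} (Ω : Set (E n)) (T : ℝ) (p : E n → ℝ) (m : ℝ)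
    (u₀ : E n → ℝ) (u : E n × ℝ → ℝ) (G : E n × ℝ → E n) (w : E n × ℝ → ℝ) : Prop where
  nonneg : ∀ᵐ z ∂(volume.restrict (cylinder Ω T)), 0 ≤ u z
  memU : MemU Ω T p u G
  memLinfty : MemLp u ∞ (volume.restrict (cylinder Ω T))
  timeDeriv : IsWeakTimeDeriv Ω T u w
  timeDeriv_memUDual : MemUDual Ω T p w
  timeDeriv_memL2 : MemLp w 2 (volume.restrict (cylinder Ω T))
  /-- The weak form; `H` is the weak gradient `D(u^m φ)`. -/
  weakForm : ∀ φ : E n × ℝ → ℝ, IsTest 1 (cylinder Ω T) φ →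
    ∃ H : E n × ℝ → E n, IsSpatialGradient Ω T (fun z => u z ^ m * φ z) H ∧
      (∫ z in cylinder Ω T, w z * φ z)
        + ∫ z in cylinder Ω T, ‖G z‖ ^ (p z.1 - 2) * inner ℝ (G z) (H z) = 0
  /-- Zero lateral boundary values. -/
  lateralTrace : ∀ᵐ t ∂(volume.restrict (Ioo 0 T)),
    MemVZero Ω p (fun x => u (x, t)) (fun x => G (x, t))
  initialTrace : HasInitialTrace Ω T u u₀

/-- `u` is a nonnegative weak solution of the problem with initial datum `u₀`. -/
def IsWeakSolution {n : ℕ} (Ω : Set (E n)) (T : ℝ) (p : E n → ℝ) (m : ℝ)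
    (u₀ : E n → ℝ) (u : E n × ℝ → ℝ) : Prop :=
  ∃ (G : E n × ℝ → E n) (w : E n × ℝ → ℝ), IsWeakSolutionWith Ω T p m u₀ u G w

/-! ### Support -/

/-- The set `F = {x ∈ Ω | f x > 0}`. -/
def posSet {n : ℕ} (Ω : Set (E n)) (f : E n → ℝ) : Set (E n) := {x ∈ Ω | 0 < f x}

/-- The support of a function `f` on `Ω`: the closure, in `Ω`, of the set of all `x ∈ F` at which
the density `lim_{r → 0} |F ∩ B_r(x)| / |B_r(x)|` exists and is positive.

If `supp_Ω` is this set and `supp` is the closure in `ℝⁿ`, then `supp_Ω f = Ω ∩ supp f` and `supp f`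
is the closure of `supp_Ω f`, so `supp f ⊆ supp g ↔ supp_Ω f ⊆ supp_Ω g`, and
`supp f ⊂ Ω` implies `supp_Ω f ⊂ Ω`. -/
def supp {n : ℕ} (Ω : Set (E n)) (f : E n → ℝ) : Set (E n) :=
  Ω ∩ closure {x ∈ posSet Ω f | ∃ l : ℝ≥0∞, 0 < l ∧
    Tendsto (fun r : ℝ => volume (posSet Ω f ∩ Metric.closedBall x r)
      / volume (Metric.closedBall x r)) (𝓝[>] 0) (𝓝 l)}

end

end PxParabolic

/-!
Fix a test function `η ≥ 0` whose support avoids `supp u₀`, and put `ψ_N(s) = 2Ns / (1 + Ns²)`, the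
derivative of the entropy `log (1 + Ns²)`. Testing the equation at almost every time with
`η ψ_N(u)` gives

`∫ η ψ_N(u) ∂ₜu + ∫ η (m ψ_N(u) + u ψ_N'(u)) u^(m-1) |Du|^p + ∫ u^m ψ_N(u) |Du|^(p-2) Du · Dη = 0`.

Since `m ≥ 1` and `ψ_N(u) + u ψ_N'(u) ≥ 0`, the middle term is nonnegative; since `u ψ_N(u) ≤ 2`,
the last one is bounded independently of `N`. As `u₀ = 0` on `{η > 0}`, integration in time bounds
`∫ η log (1 + N u(t)²)` uniformly in `N`, and `N → ∞` forces `u(t) = 0` almost everywhere on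
`{η > 0}`. The function `ψ_N(u(t))` need not be smooth, but `u(t) ∈ 𝒱₀(Ω)` is a limit of test
functions, for which the identity is legitimate.
-/

namespace PxParabolic

variable {n : ℕ}

/-! ### Measure theory -/

section Measure

variable {X Y F : Type*} [MeasurableSpace X] [MeasurableSpace Y] [NormedAddCommGroup F]
  {μ : Measure X} {ν : Measure Y}

theorem ae_ae_swap_of_ae_prod [SFinite μ] [SFinite ν] {P : X × Y → Prop}
    (h : ∀ᵐ z ∂(μ.prod ν), P z) : ∀ᵐ y ∂ν, ∀ᵐ x ∂μ, P (x, y) :=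
  Measure.ae_ae_of_ae_prod
    ((Measure.measurePreserving_swap (μ := ν) (ν := μ)).quasiMeasurePreserving.ae h)

theorem ae_eq_prod_of_ae_ae_swap [SFinite μ] [SFinite ν] {f g : X × Y → F}
    (hf : AEStronglyMeasurable f (μ.prod ν)) (hg : AEStronglyMeasurable g (μ.prod ν))
    (h : ∀ᵐ y ∂ν, ∀ᵐ x ∂μ, f (x, y) = g (x, y)) : f =ᵐ[μ.prod ν] g := by
  have hm : AEMeasurable (fun z => ‖f z - g z‖ₑ) (μ.prod ν) := (hf.sub hg).enorm
  have h0 : ∫⁻ z, ‖f z - g z‖ₑ ∂(μ.prod ν) = 0 := by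
    rw [lintegral_prod_symm _ hm]
    refine lintegral_eq_zero_of_ae_eq_zero ?_
    filter_upwards [h] with y hy
    refine lintegral_eq_zero_of_ae_eq_zero ?_
    filter_upwards [hy] with x hx
    rw [hx, sub_self, enorm_zero, Pi.zero_apply]
  filter_upwards [(lintegral_eq_zero_iff' hm).1 h0] with z hz
  exact sub_eq_zero.1 (enorm_eq_zero.1 hz)

theorem tendsto_lintegral_enorm_smul_zero_of_bounded [NormedSpace ℝ F] {a : ℕ → X → ℝ}
    {h : ℕ → X → F} {C : ℝ} (ha : ∀ k, ∀ᵐ x ∂μ, |a k x| ≤ C)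
    (hL : Tendsto (fun k => ∫⁻ x, ‖h k x‖ₑ ∂μ) atTop (𝓝 0)) :
    Tendsto (fun k => ∫⁻ x, ‖a k x • h k x‖ₑ ∂μ) atTop (𝓝 0) := by
  have hb : Tendsto (fun k => ENNReal.ofReal C * ∫⁻ x, ‖h k x‖ₑ ∂μ) atTop (𝓝 0) := by
    simpa only [mul_zero] using ENNReal.Tendsto.const_mul hL (Or.inr ENNReal.ofReal_ne_top)
  refine tendsto_of_tendsto_of_tendsto_of_le_of_le tendsto_const_nhds hb (fun _ => zero_le)
    fun k => ?_
  rw [← lintegral_const_mul' _ _ ENNReal.ofReal_ne_top]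
  refine lintegral_mono_ae ?_
  filter_upwards [ha k] with x hx
  rw [enorm_smul, ← ofReal_norm]
  gcongr
  exact hx

theorem tendsto_integral_smul_of_bounded_of_tendsto_lintegral [NormedSpace ℝ F]
    {a : ℕ → X → ℝ} {a' : X → ℝ} {h : ℕ → X → F} {h' : X → F} {C : ℝ}
    (ham : ∀ k, AEStronglyMeasurable (a k) μ) (ha : ∀ k, ∀ᵐ x ∂μ, |a k x| ≤ C)
    (hlim : ∀ᵐ x ∂μ, Tendsto (fun k => a k x) atTop (𝓝 (a' x)))
    (hh : ∀ k, AEStronglyMeasurable (h k) μ) (hh' : Integrable h' μ)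
    (hL : Tendsto (fun k => ∫⁻ x, ‖h k x - h' x‖ₑ ∂μ) atTop (𝓝 0)) :
    Tendsto (fun k => ∫ x, a k x • h k x ∂μ) atTop (𝓝 (∫ x, a' x • h' x ∂μ)) := by
  have hdiff : Tendsto (fun k => ∫ x, a k x • (h k x - h' x) ∂μ) atTop (𝓝 0) :=
    tendsto_zero_iff_enorm_tendsto_zero.2 <| tendsto_of_tendsto_of_tendsto_of_le_of_le
      tendsto_const_nhds (tendsto_lintegral_enorm_smul_zero_of_bounded ha hL)
      (fun _ => zero_le) fun k => enorm_integral_le_lintegral_enorm _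
  have hmain : Tendsto (fun k => ∫ x, a k x • h' x ∂μ) atTop (𝓝 (∫ x, a' x • h' x ∂μ)) := by
    refine tendsto_integral_of_dominated_convergence (fun x => C * ‖h' x‖)
      (fun k => (ham k).smul hh'.1) (hh'.norm.const_mul C) (fun k => ?_) ?_
    · filter_upwards [ha k] with x hx
      rw [norm_smul]
      exact mul_le_mul_of_nonneg_right hx (norm_nonneg _)
    · filter_upwards [hlim] with x hx using hx.smul_const _
  have hint : ∀ᶠ k in atTop, Integrable (fun x => a k x • (h k x - h' x)) μ := by
    filter_upwards [hL.eventually (gt_mem_nhds ENNReal.zero_lt_top)] with k hk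
    exact Integrable.bdd_smul ⟨(hh k).sub hh'.1, hk⟩ C (ham k) (ha k)
  have hsum := hdiff.add hmain
  rw [zero_add] at hsum
  refine hsum.congr' ?_
  filter_upwards [hint] with k hk
  have hk' : Integrable (fun x => a k x • h' x) μ := hh'.bdd_smul C (ham k) (ha k)
  rw [← integral_add hk hk']
  simp only [smul_sub, sub_add_cancel]

theorem ae_not_tendsto_atTop_of_integral_le {f : ℕ → X → ℝ} {K : ℝ} (hf : ∀ k, 0 ≤ᵐ[μ] f k)
    (hi : ∀ k, Integrable (f k) μ) (hK : ∀ k, ∫ x, f k x ∂μ ≤ K) :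
    ∀ᵐ x ∂μ, ¬ Tendsto (fun k => f k x) atTop atTop := by
  set F : ℕ → X → ℝ≥0∞ := fun k x => ENNReal.ofReal (f k x)
  have hm : ∀ k, AEMeasurable (F k) μ := fun k => (hi k).1.aemeasurable.ennreal_ofReal
  have hlim : AEMeasurable (fun x => liminf (fun k => F k x) atTop) μ := by
    simp only [liminf_eq_iSup_iInf_of_nat]
    exact AEMeasurable.iSup fun i => AEMeasurable.biInf _ (to_countable _) fun j _ => hm j
  have hfatou : ∫⁻ x, liminf (fun k => F k x) atTop ∂μ ≤ ENNReal.ofReal K := by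
    refine (lintegral_liminf_le' hm).trans
      (liminf_le_of_frequently_le' (Frequently.of_forall fun k => ?_))
    rw [← ofReal_integral_eq_lintegral_ofReal (hi k) (hf k)]
    exact ENNReal.ofReal_le_ofReal (hK k)
  filter_upwards [ae_lt_top' hlim (hfatou.trans_lt ENNReal.ofReal_lt_top).ne] with x hx htop
  exact hx.ne (ENNReal.tendsto_ofReal_nhds_top.2 htop).liminf_eq

theorem integrable_inner_of_bounded [InnerProductSpace ℝ F] {A V : X → F} (hA : Integrable A μ)
    (hV : AEStronglyMeasurable V μ) {C : ℝ} (hC : ∀ᵐ x ∂μ, ‖V x‖ ≤ C) :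
    Integrable (fun x => inner ℝ (A x) (V x)) μ := by
  refine (hA.norm.const_mul C).mono' (hA.1.inner hV) ?_
  filter_upwards [hC] with x hx
  calc ‖inner ℝ (A x) (V x)‖ ≤ ‖A x‖ * ‖V x‖ := norm_inner_le_norm _ _
    _ ≤ C * ‖A x‖ := by rw [mul_comm]; gcongr

end Measure

/-! ### Test functions -/

section Test

variable {X : Type*} [NormedAddCommGroup X] [NormedSpace ℝ X] {U V : Set X} {φ θ : X → ℝ}
  {k l : WithTop ℕ∞}

theorem IsTest.of_le (h : IsTest k U φ) (hl : l ≤ k) : IsTest l U φ :=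
  ⟨h.1.of_le hl, h.2⟩

theorem IsTest.mono (h : IsTest k U φ) (hUV : U ⊆ V) : IsTest k V φ :=
  ⟨h.1, h.2.1, h.2.2.trans hUV⟩

theorem IsTest.eq_zero (h : IsTest k U φ) {x : X} (hx : x ∉ U) : φ x = 0 :=
  image_eq_zero_of_notMem_tsupport fun hh => hx (h.2.2 hh)

theorem IsTest.exists_bound (h : IsTest k U φ) : ∃ C, ∀ x, |φ x| ≤ C :=
  h.2.1.exists_bound_of_continuous h.1.continuous

theorem IsTest.setIntegral_mul_eq_integral [MeasurableSpace X] {μ : Measure X}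
    (h : IsTest k U φ) (f : X → ℝ) : ∫ x in U, f x * φ x ∂μ = ∫ x, f x * φ x ∂μ :=
  setIntegral_eq_integral_of_forall_compl_eq_zero fun x hx => by rw [h.eq_zero hx, mul_zero]

theorem IsTest.sub_const_mul (h : IsTest k U φ) (hθ : IsTest k U θ) (c : ℝ) :
    IsTest k U fun x => φ x - c * θ x := by
  have hsub : tsupport (fun x => φ x - c * θ x) ⊆ tsupport φ ∪ tsupport θ :=
    (tsupport_sub _ _).trans
      (union_subset_union_right _ (tsupport_mul_subset_right (f := fun _ => c)))
  have hcomp : IsCompact (tsupport φ ∪ tsupport θ) := h.2.1.isCompact.union hθ.2.1.isCompact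
  exact ⟨h.1.sub (contDiff_const.mul hθ.1), hcomp.of_isClosed_subset (isClosed_tsupport _) hsub,
    hsub.trans (union_subset h.2.2 hθ.2.2)⟩

end Test

/-! ### Weak derivatives on an interval -/

section Interval

theorem absolutelyContinuousOnInterval_comp {X Y : Type*} [PseudoMetricSpace X]
    [PseudoMetricSpace Y] {f : ℝ → X} {Ψ : X → Y} {K : ℝ≥0} {a b : ℝ} (hΨ : LipschitzWith K Ψ)
    (hf : AbsolutelyContinuousOnInterval f a b) :
    AbsolutelyContinuousOnInterval (fun t => Ψ (f t)) a b := by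
  refine squeeze_zero (fun I => Finset.sum_nonneg fun _ _ => dist_nonneg) (fun I => ?_)
    (by simpa only [mul_zero] using Tendsto.const_mul (K : ℝ) hf)
  rw [Finset.mul_sum]
  exact Finset.sum_le_sum fun i _ => hΨ.dist_le_mul _ _

variable {a b : ℝ}

theorem comp_primitive_sub_eq_integral {w Ψ ψ : ℝ → ℝ} {K : ℝ≥0} {c t : ℝ}
    (hw : IntervalIntegrable w volume a b) (ht : t ∈ Icc a b)
    (hΨ : ∀ s, HasDerivAt Ψ (ψ s) s) (hK : LipschitzWith K Ψ) :
    Ψ (c + ∫ r in a..t, w r) - Ψ c = ∫ s in a..t, ψ (c + ∫ r in a..s, w r) * w s := by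
  have hwt : IntervalIntegrable w volume a t := hw.mono_set <| by
    rw [uIcc_of_le ht.1, uIcc_of_le (ht.1.trans ht.2)]; exact Icc_subset_Icc_right ht.2
  have hAC : AbsolutelyContinuousOnInterval (fun s => Ψ (c + ∫ r in a..s, w r)) a t :=
    absolutelyContinuousOnInterval_comp (Ψ := fun y => Ψ (c + y))
      (LipschitzWith.of_dist_le_mul fun x y => by
        simpa only [dist_add_left] using hK.dist_le_mul (c + x) (c + y))
      (hwt.absolutelyContinuousOnInterval_intervalIntegral left_mem_uIcc)
  have hFTC := hAC.integral_deriv_eq_sub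
  simp only [intervalIntegral.integral_same, add_zero] at hFTC
  rw [← hFTC]
  refine intervalIntegral.integral_congr_ae ?_
  filter_upwards [hwt.ae_hasDerivAt_integral] with s hs hst
  exact ((hΨ _).comp s ((hs (uIoc_subset_uIcc hst) a left_mem_uIcc).const_add c)).deriv

theorem exists_Icc_of_isCompact_subset_Ioo {K : Set ℝ} (hK : IsCompact K) (hne : K.Nonempty)
    (hKab : K ⊆ Ioo a b) : ∃ c d, a < c ∧ d < b ∧ K ⊆ Icc c d := by
  obtain ⟨c, hc, hc'⟩ := hK.exists_isLeast hne
  obtain ⟨d, hd, hd'⟩ := hK.exists_isGreatest hne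
  exact ⟨c, d, (hKab hc).1, (hKab hd).2, fun x hx => ⟨hc' hx, hd' hx⟩⟩

theorem exists_isTest_Ioo_integral_eq_one (hab : a < b) :
    ∃ ζ : ℝ → ℝ, IsTest ∞ (Ioo a b) ζ ∧ ∫ t, ζ t = 1 := by
  let β : ContDiffBump ((a + b) / 2) := ⟨(b - a) / 8, (b - a) / 4, by linarith, by linarith⟩
  refine ⟨β.normed volume, ⟨β.contDiff_normed, β.hasCompactSupport_normed, ?_⟩, β.integral_normed⟩
  rw [β.tsupport_normed_eq, Real.closedBall_eq_Icc]
  rintro x ⟨hx₁, hx₂⟩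
  constructor <;> simp only [β] at hx₁ hx₂ <;> linarith

theorem IsTest.exists_primitive {ζ : ℝ → ℝ} (hζ : IsTest ∞ (Ioo a b) ζ) (h0 : ∫ t, ζ t = 0) :
    ∃ χ, IsTest ∞ (Ioo a b) χ ∧ deriv χ = ζ := by
  rcases (tsupport ζ).eq_empty_or_nonempty with hempty | hne
  · have hζ0 : ζ = 0 := tsupport_eq_empty_iff.1 hempty
    exact ⟨0, by rw [← hζ0]; exact hζ, by rw [hζ0]; exact funext fun t => deriv_const t 0⟩
  obtain ⟨c, d, hac, hdb, hcd⟩ := exists_Icc_of_isCompact_subset_Ioo hζ.2.1.isCompact hne hζ.2.2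
  have hzero : ∀ r ∉ Icc c d, ζ r = 0 := fun r hr =>
    image_eq_zero_of_notMem_tsupport fun h => hr (hcd h)
  set χ : ℝ → ℝ := fun t => ∫ r in a..t, ζ r
  have hderiv : ∀ t, HasDerivAt χ (ζ t) t := fun t =>
    (hζ.1.continuous.integral_hasStrictDerivAt a t).hasDerivAt
  have hχ' : deriv χ = ζ := funext fun t => (hderiv t).deriv
  have hleft : ∀ t < c, χ t = 0 := fun t ht =>
    intervalIntegral.integral_zero_ae <| Eventually.of_forall fun r hr => hzero r fun h =>
      (h.1.trans (uIoc_subset_uIcc hr).2).not_gt (max_lt hac ht)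
  have hright : ∀ t > d, χ t = 0 := fun t ht => by
    rw [← h0]
    refine intervalIntegral.integral_eq_integral_of_support_subset fun r hr => ?_
    have hr' : r ∈ Icc c d := by_contra fun h => hr (hzero r h)
    exact ⟨hac.trans_le hr'.1, hr'.2.trans ht.le⟩
  have hsupp : tsupport χ ⊆ Icc c d := closure_minimal (fun t ht => by
    by_contra h
    rcases not_and_or.1 h with h | h
    exacts [ht (hleft t (not_le.1 h)), ht (hright t (not_le.1 h))]) isClosed_Icc
  refine ⟨χ, ⟨?_, isCompact_Icc.of_isClosed_subset (isClosed_tsupport χ) hsupp,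
    hsupp.trans (Icc_subset_Ioo hac hdb)⟩, hχ'⟩
  rw [contDiff_infty_iff_deriv, hχ']
  exact ⟨fun t => (hderiv t).differentiableAt, hζ.1⟩

theorem IsTest.integrableOn_mul {X : Type*} [NormedAddCommGroup X] [NormedSpace ℝ X]
    [MeasurableSpace X] [BorelSpace X] {μ : Measure X} {U : Set X} {k : WithTop ℕ∞} {χ f : X → ℝ}
    (hχ : IsTest k U χ) (hf : IntegrableOn f U μ) : IntegrableOn (fun x => f x * χ x) U μ := by
  obtain ⟨C, hC⟩ := hχ.exists_bound
  exact hf.mul_bdd hχ.1.continuous.aestronglyMeasurable (Eventually.of_forall hC)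

theorem exists_ae_eq_const_of_integral_mul_deriv_eq_zero {k : ℝ → ℝ} (hab : a < b)
    (hk : IntegrableOn k (Ioo a b))
    (hw : ∀ χ, IsTest ∞ (Ioo a b) χ → ∫ t in Ioo a b, k t * deriv χ t = 0) :
    ∃ c, ∀ᵐ t ∂(volume.restrict (Ioo a b)), k t = c := by
  obtain ⟨ζ₀, hζ₀, hζ₀1⟩ := exists_isTest_Ioo_integral_eq_one hab
  set c : ℝ := ∫ t in Ioo a b, k t * ζ₀ t
  refine ⟨c, (ae_restrict_iff' measurableSet_Ioo).2 ?_⟩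
  have hc : IntegrableOn (fun _ => c) (Ioo a b) := integrableOn_const (by simp)
  suffices ∀ᵐ t, t ∈ Ioo a b → k t - c = 0 from
    this.mono fun t ht hmem => sub_eq_zero.1 (ht hmem)
  refine isOpen_Ioo.ae_eq_zero_of_integral_contDiff_smul_eq_zero (hk.sub hc).locallyIntegrableOn
    fun ζ hζs hζc hζU => ?_
  have hζ : IsTest ∞ (Ioo a b) ζ := ⟨hζs, hζc, hζU⟩
  set d : ℝ := ∫ t, ζ t
  obtain ⟨χ, hχ, hχ'⟩ := (hζ.sub_const_mul hζ₀ d).exists_primitive <| by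
    rw [integral_sub (hζs.continuous.integrable_of_hasCompactSupport hζc)
      ((hζ₀.1.continuous.integrable_of_hasCompactSupport hζ₀.2.1).const_mul d),
      integral_const_mul, hζ₀1, mul_one, sub_self]
  have hcζ : ∫ t in Ioo a b, c * ζ t = d * c := by
    rw [hζ.setIntegral_mul_eq_integral fun _ => c, integral_const_mul, mul_comm]
  calc ∫ t, ζ t • (k t - c) = ∫ t in Ioo a b, (k t - c) * ζ t := by
        rw [hζ.setIntegral_mul_eq_integral fun t => k t - c]
        simp only [smul_eq_mul, mul_comm]
    _ = (∫ t in Ioo a b, k t * ζ t) - d * c := by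
        rw [← hcζ, ← integral_sub (hζ.integrableOn_mul hk) (hζ.integrableOn_mul hc)]
        simp only [sub_mul]
    _ = ∫ t in Ioo a b, k t * deriv χ t := by
        rw [hχ', ← integral_const_mul, ← integral_sub (hζ.integrableOn_mul hk)
          ((hζ₀.integrableOn_mul hk).const_mul d)]
        simp only [mul_sub, mul_left_comm]
    _ = 0 := hw χ hχ

theorem integral_primitive_mul_deriv {h χ : ℝ → ℝ} (hab : a ≤ b)
    (hh : IntervalIntegrable h volume a b) (hχ : IsTest ∞ (Ioo a b) χ) :
    ∫ t in Ioo a b, (∫ r in a..t, h r) * deriv χ t = -∫ t in Ioo a b, h t * χ t := by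
  have hparts := (hh.absolutelyContinuousOnInterval_intervalIntegral (c := a)
    left_mem_uIcc).integral_mul_deriv_eq_deriv_mul
      ((hχ.of_le (l := 1) (by simp)).1.contDiffOn.absolutelyContinuousOnInterval)
  rw [hχ.eq_zero (x := b) (by simp), hχ.eq_zero (x := a) (by simp)] at hparts
  simp only [mul_zero, sub_self, zero_sub] at hparts
  rw [← integral_Ioc_eq_integral_Ioo, ← integral_Ioc_eq_integral_Ioo,
    ← intervalIntegral.integral_of_le hab, ← intervalIntegral.integral_of_le hab, hparts, neg_inj]
  refine intervalIntegral.integral_congr_ae ?_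
  filter_upwards [hh.ae_hasDerivAt_integral] with s hs hsI
  rw [(hs (uIoc_subset_uIcc hsI) a left_mem_uIcc).deriv]

theorem eq_add_integral_of_weakDeriv {g h : ℝ → ℝ} (hab : a < b)
    (hg : ContinuousOn g (Icc a b)) (hh : IntervalIntegrable h volume a b)
    (hw : ∀ χ, IsTest ∞ (Ioo a b) χ →
      ∫ t in Ioo a b, g t * deriv χ t = -∫ t in Ioo a b, h t * χ t) :
    ∀ t ∈ Icc a b, g t = g a + ∫ r in a..t, h r := by
  set J : ℝ → ℝ := fun t => ∫ r in a..t, h r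
  have hJc : ContinuousOn J (Icc a b) := by
    have := (hh.absolutelyContinuousOnInterval_intervalIntegral (c := a) left_mem_uIcc).continuousOn
    rwa [uIcc_of_le hab.le] at this
  have hint : ∀ {f : ℝ → ℝ}, ContinuousOn f (Icc a b) → IntegrableOn f (Ioo a b) := fun hf =>
    hf.integrableOn_Icc.mono_set Ioo_subset_Icc_self
  obtain ⟨c, hc⟩ := exists_ae_eq_const_of_integral_mul_deriv_eq_zero hab (hint (hg.sub hJc))
    fun χ hχ => by
      have hχ' : ContinuousOn (deriv χ) (Icc a b) :=
        (hχ.1.continuous_deriv (by simp)).continuousOn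
      calc ∫ t in Ioo a b, (g t - J t) * deriv χ t
          = (∫ t in Ioo a b, g t * deriv χ t) - ∫ t in Ioo a b, J t * deriv χ t := by
            simp only [sub_mul]
            exact integral_sub (hint (hg.mul hχ')) (hint (hJc.mul hχ'))
        _ = 0 := by rw [hw χ hχ, integral_primitive_mul_deriv hab.le hh hχ, sub_self]
  have hconst : EqOn (fun t => g t - J t) (fun _ => c) (Icc a b) := by
    refine (Measure.eqOn_open_of_ae_eq hc isOpen_Ioo ((hg.sub hJc).mono Ioo_subset_Icc_self)
      continuousOn_const).of_subset_closure (hg.sub hJc) continuousOn_const Ioo_subset_Icc_self ?_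
    rw [closure_Ioo hab.ne]
  intro t ht
  have hat : g t - J t = g a - J a := (hconst ht).trans (hconst (left_mem_Icc.2 hab.le)).symm
  have ha : J a = 0 := intervalIntegral.integral_same
  linarith

end Interval

/-! ### Supports -/

section Support

variable {Ω : Set (E n)} {f g : E n → ℝ}

theorem ae_nonpos_of_notMem_supp (Ω : Set (E n)) (f : E n → ℝ) :
    ∀ᵐ x, x ∈ Ω \ supp Ω f → f x ≤ 0 := by
  filter_upwards [ae_imp_of_ae_restrict
    (Besicovitch.ae_tendsto_measure_inter_div volume (posSet Ω f))] with x hx hxΩ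
  by_contra! hpos
  exact hxΩ.2 ⟨hxΩ.1, subset_closure ⟨⟨hxΩ.1, hpos⟩, 1, one_pos, hx ⟨hxΩ.1, hpos⟩⟩⟩

theorem isOpen_diff_supp (hΩ : IsOpen Ω) (f : E n → ℝ) : IsOpen (Ω \ supp Ω f) := by
  rw [supp, sdiff_self_inter]
  exact hΩ.sdiff isClosed_closure

theorem supp_subset_supp_of_ae_nonpos (hΩ : IsOpen Ω)
    (h : ∀ᵐ x, x ∈ Ω \ supp Ω g → f x ≤ 0) : supp Ω f ⊆ supp Ω g := by
  rintro x ⟨hxΩ, hx⟩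
  by_contra hxg
  have hW := isOpen_diff_supp hΩ g
  obtain ⟨y, hyW, -, l, hl, hlim⟩ := mem_closure_iff.1 hx _ hW ⟨hxΩ, hxg⟩
  obtain ⟨ε, hε, hball⟩ := Metric.isOpen_iff.1 hW y hyW
  have hnull : ∀ r ∈ Ioo 0 ε, volume (posSet Ω f ∩ Metric.closedBall y r) = 0 := fun r hr => by
    refine measure_mono_null (fun z hz => ?_) (ae_iff.1 h)
    exact fun hzf => (hzf (hball (Metric.closedBall_subset_ball hr.2 hz.2))).not_gt hz.1.2
  have hzero : Tendsto (fun r : ℝ => volume (posSet Ω f ∩ Metric.closedBall y r)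
      / volume (Metric.closedBall y r)) (𝓝[>] 0) (𝓝 0) := by
    refine tendsto_const_nhds.congr' ?_
    filter_upwards [Ioo_mem_nhdsGT hε] with r hr
    rw [hnull r hr, ENNReal.zero_div]
  exact hl.ne' (tendsto_nhds_unique hlim hzero)

theorem exists_countable_isTest_cover {W : Set (E n)} (hW : IsOpen W) :
    ∃ S : Set (E n → ℝ), S.Countable ∧ (∀ η ∈ S, IsTest ∞ W η ∧ ∀ x, 0 ≤ η x) ∧
      ∀ x ∈ W, ∃ η ∈ S, 0 < η x := by
  have hbump : ∀ x : W, ∃ η, (IsTest ∞ W η ∧ ∀ y, 0 ≤ η y) ∧ 0 < η x := fun x => by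
    obtain ⟨η, hηW, hηc, hηs, hη01, hηx⟩ :=
      exists_contDiff_tsupport_subset (n := ⊤) (hW.mem_nhds x.2)
    exact ⟨η, ⟨⟨hηs, hηc, hηW⟩, fun y => (hη01 (mem_range_self y)).1⟩, by rw [hηx]; exact one_pos⟩
  choose η hη hηpos using hbump
  obtain ⟨S, hS, hcover⟩ := TopologicalSpace.countable_cover_nhds fun x : W =>
    (((hη x).1.1.continuous.comp continuous_subtype_val).isOpen_preimage _ isOpen_Ioi).mem_nhds
      (hηpos x)
  refine ⟨η '' S, hS.image η, forall_mem_image.2 fun x _ => hη x, fun x hx => ?_⟩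
  obtain ⟨y, hyS, hxy⟩ := mem_iUnion₂.1 (hcover.ge (mem_univ (⟨x, hx⟩ : W)))
  exact ⟨η y, mem_image_of_mem η hyS, hxy⟩

end Support

/-! ### Gradients of smooth functions -/

section Gradient

variable {H : Type*} [NormedAddCommGroup H] [InnerProductSpace ℝ H] [CompleteSpace H]
  {U : Set H} {f g φ : H → ℝ} {x : H}

theorem gradient_mul (hf : DifferentiableAt ℝ f x) (hg : DifferentiableAt ℝ g x) :
    gradient (fun y => f y * g y) x = f x • gradient g x + g x • gradient f x := by
  simp only [gradient, fderiv_fun_mul hf hg, map_add, map_smul]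

theorem gradient_comp {F : ℝ → ℝ} (hF : DifferentiableAt ℝ F (f x))
    (hf : DifferentiableAt ℝ f x) :
    gradient (fun y => F (f y)) x = deriv F (f x) • gradient f x := by
  have := (hF.hasDerivAt.comp_hasFDerivAt x hf.hasFDerivAt).fderiv
  simp only [gradient, Function.comp_def] at this ⊢
  rw [this, map_smul]

theorem continuous_gradient (hf : ContDiff ℝ 1 f) : Continuous (gradient f) :=
  (LinearIsometryEquiv.continuous _).comp (hf.continuous_fderiv one_ne_zero)

theorem tsupport_gradient_subset (φ : H → ℝ) : tsupport (gradient φ) ⊆ tsupport φ :=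
  (closure_mono (Function.support_comp_subset (map_zero _) (fderiv ℝ φ))).trans
    (tsupport_fderiv_subset ℝ)

theorem IsTest.gradient_eq_zero {k : WithTop ℕ∞} (h : IsTest k U φ) (hx : x ∉ U) :
    gradient φ x = 0 :=
  image_eq_zero_of_notMem_tsupport fun hh => hx (h.2.2 (tsupport_gradient_subset φ hh))

theorem IsTest.hasCompactSupport_gradient {k : WithTop ℕ∞} (h : IsTest k U φ) :
    HasCompactSupport (gradient φ) :=
  h.2.1.isCompact.of_isClosed_subset (isClosed_tsupport _) (tsupport_gradient_subset φ)

theorem IsTest.exists_gradient_bound (h : IsTest 1 U φ) : ∃ C, ∀ x, ‖gradient φ x‖ ≤ C :=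
  h.hasCompactSupport_gradient.exists_bound_of_continuous (continuous_gradient h.1)

theorem setIntegral_smul_gradient {Ω : Set (E n)} {f φ : E n → ℝ} (hf : ContDiff ℝ 1 f)
    (hφ : IsTest 1 Ω φ) :
    ∫ x in Ω, f x • gradient φ x = -∫ x in Ω, φ x • gradient f x := by
  have hfgrad : Integrable (fun x => f x • gradient φ x) :=
    (hf.continuous.smul (continuous_gradient hφ.1)).integrable_of_hasCompactSupport
      hφ.hasCompactSupport_gradient.smul_left
  have hgradf : Integrable (fun x => φ x • gradient f x) :=
    (hφ.1.continuous.smul (continuous_gradient hf)).integrable_of_hasCompactSupport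
      hφ.2.1.smul_right
  have hprod : Integrable (fun x => f x * φ x) :=
    (hf.continuous.mul hφ.1.continuous).integrable_of_hasCompactSupport hφ.2.1.mul_left
  have hinner : ∀ (v : E n) (c : ℝ) (ξ : E n → ℝ) (x : E n),
      inner ℝ v (c • gradient ξ x) = c * fderiv ℝ ξ x v := fun v c ξ x => by
    rw [inner_smul_right, inner_gradient_right, conj_trivial]
  rw [setIntegral_eq_integral_of_forall_compl_eq_zero
      (fun x hx => by rw [hφ.gradient_eq_zero hx, smul_zero]),
    setIntegral_eq_integral_of_forall_compl_eq_zero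
      (fun x hx => by rw [hφ.eq_zero hx, zero_smul])]
  refine ext_inner_left ℝ fun v => ?_
  have hfgrad' := hfgrad.const_inner (𝕜 := ℝ) v
  have hgradf' := hgradf.const_inner (𝕜 := ℝ) v
  rw [inner_neg_right, ← integral_inner hfgrad, ← integral_inner hgradf]
  simp only [hinner, mul_comm (φ _)] at hfgrad' hgradf' ⊢
  exact integral_mul_fderiv_eq_neg_fderiv_mul_of_integrable hgradf' hfgrad' hprod
    (fun x _ => hf.differentiable one_ne_zero x) (fun x _ => hφ.1.differentiable one_ne_zero x)

end Gradient

/-! ### Variable exponents -/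

theorem IsLogHolderExponent.continuousOn {Ω : Set (E n)} {p : E n → ℝ}
    (hp : IsLogHolderExponent Ω p) : ContinuousOn p (closure Ω) := by
  obtain ⟨C, hC⟩ := hp.logHolder
  have hmodulus : Tendsto (fun d : ℝ => C / Real.log (Real.exp 1 + 1 / d)) (𝓝[>] 0) (𝓝 0) := by
    refine tendsto_const_nhds.div_atTop (Real.tendsto_log_atTop.comp ?_)
    exact tendsto_atTop_add_const_left _ _
      (tendsto_inv_nhdsGT_zero.congr fun x => (one_div x).symm)
  refine Metric.continuousOn_iff.2 fun x hx ε hε => ?_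
  obtain ⟨δ, hδ, hlt⟩ :=
    (mem_nhdsGT_iff_exists_Ioo_subset).1 (hmodulus.eventually (gt_mem_nhds hε))
  refine ⟨δ, hδ, fun y hy hyx => ?_⟩
  rcases eq_or_ne y x with rfl | hne
  · simpa only [dist_self] using hε
  · exact (hC y hy x hx).trans_lt (hlt ⟨dist_pos.2 hne, hyx⟩)

theorem IsLogHolderExponent.aemeasurable {Ω : Set (E n)} {p : E n → ℝ}
    (hp : IsLogHolderExponent Ω p) (hΩ : MeasurableSet Ω) :
    AEMeasurable p (volume.restrict Ω) :=
  (hp.continuousOn.mono subset_closure).aemeasurable hΩ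

theorem IsLogHolderExponent.ae_one_lt {Ω : Set (E n)} {p : E n → ℝ}
    (hp : IsLogHolderExponent Ω p) (hΩ : MeasurableSet Ω) :
    ∀ᵐ x ∂(volume.restrict Ω), 1 < p x := by
  obtain ⟨q, Q, hq, hbounds⟩ := hp.bounds
  filter_upwards [ae_restrict_mem hΩ] with x hx
  exact hq.trans_le (hbounds x (subset_closure hx)).1

theorem rpow_sub_one_mul_le {a b q : ℝ} (ha : 0 ≤ a) (hb : 0 ≤ b) (hq : 1 ≤ q) :
    a ^ (q - 1) * b ≤ a ^ q + b ^ q := by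
  have hmul : ∀ c : ℝ, 0 ≤ c → c ^ (q - 1) * c = c ^ q := fun c hc => by
    rw [← Real.rpow_add_one' hc (by linarith), sub_add_cancel]
  rcases le_total b a with h | h
  · calc a ^ (q - 1) * b ≤ a ^ (q - 1) * a := by gcongr
      _ = a ^ q := hmul a ha
      _ ≤ a ^ q + b ^ q := le_add_of_nonneg_right (by positivity)
  · calc a ^ (q - 1) * b ≤ b ^ (q - 1) * b := by gcongr
      _ = b ^ q := hmul b hb
      _ ≤ a ^ q + b ^ q := le_add_of_nonneg_left (by positivity)

theorem le_one_add_rpow {a q : ℝ} (ha : 0 ≤ a) (hq : 1 ≤ q) : a ≤ 1 + a ^ q := by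
  simpa only [Real.one_rpow, one_mul] using rpow_sub_one_mul_le zero_le_one ha hq

theorem rpow_sub_one_le_one_add_rpow {a q : ℝ} (ha : 0 ≤ a) (hq : 1 ≤ q) :
    a ^ (q - 1) ≤ 1 + a ^ q := by
  simpa only [Real.one_rpow, mul_one, add_comm] using rpow_sub_one_mul_le ha zero_le_one hq

section Luxemburg

variable {X F : Type*} [MeasurableSpace X] {μ : Measure X} [NormedAddCommGroup F]
  [NormedSpace ℝ F] {p a : X → ℝ}

-- A crude form of Hölder's inequality: Young's inequality is applied to `a` and `h / α`, for
-- every `α` admissible in the Luxemburg norm.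
theorem lintegral_rpow_sub_one_mul_le_luxNorm (hp : ∀ᵐ x ∂μ, 1 ≤ p x) (ha : ∀ x, 0 ≤ a x)
    (hap : Integrable (fun x => a x ^ p x) μ) (h : X → F) :
    ∫⁻ x, ENNReal.ofReal (a x ^ (p x - 1)) * ‖h x‖ₑ ∂μ ≤
      luxNorm μ p h * ((∫⁻ x, ENNReal.ofReal (a x ^ p x) ∂μ) + 1) := by
  set J := (∫⁻ x, ENNReal.ofReal (a x ^ p x) ∂μ) + 1
  have hJ : J ≠ ⊤ := ENNReal.add_ne_top.2 ⟨hap.lintegral_lt_top.ne, ENNReal.one_ne_top⟩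
  rw [← ENNReal.div_le_iff (by positivity) hJ]
  refine le_iInf₂ fun α hα => ?_
  have hyoung : ∀ᵐ x ∂μ, ENNReal.ofReal (a x ^ (p x - 1)) * ‖h x‖ₑ ≤
      ENNReal.ofReal α * (ENNReal.ofReal (a x ^ p x) + ‖α⁻¹ • h x‖ₑ ^ p x) := by
    filter_upwards [hp] with x hx
    have hscale : ‖h x‖ = α * ‖α⁻¹ • h x‖ := by
      rw [norm_smul, norm_inv, Real.norm_of_nonneg hα.1.le, mul_inv_cancel_left₀ hα.1.ne']
    rw [← ofReal_norm (α⁻¹ • h x), ENNReal.ofReal_rpow_of_nonneg (norm_nonneg _) (by linarith),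
      ← ENNReal.ofReal_add (Real.rpow_nonneg (ha x) _) (by positivity),
      ← ENNReal.ofReal_mul hα.1.le, ← ofReal_norm, hscale,
      ← ENNReal.ofReal_mul (Real.rpow_nonneg (ha x) _), mul_left_comm]
    have := rpow_sub_one_mul_le (ha x) (norm_nonneg (α⁻¹ • h x)) hx
    exact ENNReal.ofReal_le_ofReal (mul_le_mul_of_nonneg_left this hα.1.le)
  refine ENNReal.div_le_of_le_mul ((lintegral_mono_ae hyoung).trans ?_)
  rw [lintegral_const_mul' _ _ ENNReal.ofReal_ne_top,
    lintegral_add_left' hap.1.aemeasurable.ennreal_ofReal]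
  exact mul_le_mul_right (add_le_add_right hα.2 _) _

theorem tendsto_lintegral_rpow_sub_one_mul_of_luxNorm (hp : ∀ᵐ x ∂μ, 1 ≤ p x)
    (ha : ∀ x, 0 ≤ a x) (hap : Integrable (fun x => a x ^ p x) μ) {h : ℕ → X → F}
    (hlim : Tendsto (fun k => luxNorm μ p (h k)) atTop (𝓝 0)) :
    Tendsto (fun k => ∫⁻ x, ENNReal.ofReal (a x ^ (p x - 1)) * ‖h k x‖ₑ ∂μ) atTop (𝓝 0) := by
  have hJ : (∫⁻ x, ENNReal.ofReal (a x ^ p x) ∂μ) + 1 ≠ ⊤ :=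
    ENNReal.add_ne_top.2 ⟨hap.lintegral_lt_top.ne, ENNReal.one_ne_top⟩
  refine tendsto_of_tendsto_of_tendsto_of_le_of_le tendsto_const_nhds
    (by simpa only [zero_mul] using ENNReal.Tendsto.mul_const hlim (Or.inr hJ))
    (fun _ => zero_le) fun k => lintegral_rpow_sub_one_mul_le_luxNorm hp ha hap (h k)

theorem tendsto_lintegral_enorm_of_luxNorm [IsFiniteMeasure μ] (hp : ∀ᵐ x ∂μ, 1 ≤ p x)
    {h : ℕ → X → F} (hlim : Tendsto (fun k => luxNorm μ p (h k)) atTop (𝓝 0)) :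
    Tendsto (fun k => ∫⁻ x, ‖h k x‖ₑ ∂μ) atTop (𝓝 0) := by
  simpa only [Real.one_rpow, ENNReal.ofReal_one, one_mul] using
    tendsto_lintegral_rpow_sub_one_mul_of_luxNorm (a := fun _ => 1) hp (fun _ => zero_le_one)
      (by simpa only [Real.one_rpow] using integrable_const (1 : ℝ)) hlim

end Luxemburg

/-! ### The flux of the `p`-Laplacian -/

section Flux

variable {F : Type*} [NormedAddCommGroup F] [InnerProductSpace ℝ F]

/-- The flux `|a|^{q-2} a` of the `q`-Laplacian. For `q < 2` and `a = 0` the junk value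
`0 ^ (q - 2) = 0` is harmless, as it multiplies `a`. -/
noncomputable def pFlux (q : ℝ) (a : F) : F := ‖a‖ ^ (q - 2) • a

theorem inner_pFlux_self {q : ℝ} (hq : q ≠ 0) (a : F) : inner ℝ (pFlux q a) a = ‖a‖ ^ q := by
  rcases eq_or_ne a 0 with rfl | ha
  · rw [inner_zero_right, norm_zero, Real.zero_rpow hq]
  · rw [pFlux, real_inner_smul_left, real_inner_self_eq_norm_sq, ← Real.rpow_natCast,
      ← Real.rpow_add (norm_pos_iff.2 ha), Nat.cast_ofNat, sub_add_cancel]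

theorem norm_pFlux_le (q : ℝ) (a : F) : ‖pFlux q a‖ ≤ ‖a‖ ^ (q - 1) := by
  rcases eq_or_ne a 0 with rfl | ha
  · rw [pFlux, smul_zero, norm_zero]
    positivity
  · rw [pFlux, norm_smul, Real.norm_of_nonneg (by positivity),
      ← Real.rpow_add_one (norm_ne_zero_iff.2 ha), sub_add, show (2 : ℝ) - 1 = 1 by norm_num]

theorem norm_pFlux_le_one_add {q : ℝ} (hq : 1 ≤ q) (a : F) : ‖pFlux q a‖ ≤ 1 + ‖a‖ ^ q :=
  (norm_pFlux_le q a).trans (rpow_sub_one_le_one_add_rpow (norm_nonneg a) hq)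

theorem aestronglyMeasurable_pFlux {X : Type*} [MeasurableSpace X] {μ : Measure X} {p : X → ℝ}
    {g : X → F} (hp : AEMeasurable p μ) (hg : AEStronglyMeasurable g μ) :
    AEStronglyMeasurable (fun x => pFlux (p x) (g x)) μ :=
  (hg.norm.aemeasurable.pow (hp.sub_const 2)).aestronglyMeasurable.smul hg

end Flux

/-! ### Approximation of functions with zero boundary values -/

section Approximation

variable {Ω : Set (E n)} {p v : E n → ℝ} {g : E n → E n}

theorem MemV.aestronglyMeasurable (h : MemV Ω p v g) :
    AEStronglyMeasurable v (volume.restrict Ω) :=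
  h.1.aestronglyMeasurable

theorem MemV.aestronglyMeasurable_gradient (h : MemV Ω p v g) :
    AEStronglyMeasurable g (volume.restrict Ω) :=
  h.2.1.2.1.aestronglyMeasurable

theorem MemV.integrable_gradient [IsFiniteMeasure (volume.restrict Ω)] (h : MemV Ω p v g)
    (hp : ∀ᵐ x ∂(volume.restrict Ω), 1 ≤ p x) : Integrable g (volume.restrict Ω) := by
  refine ((integrable_const (1 : ℝ)).add h.2.2).mono' h.aestronglyMeasurable_gradient ?_
  filter_upwards [hp] with x hx using le_one_add_rpow (norm_nonneg _) hx

/-- A sequence of test functions approximating a function `v` with weak gradient `g` well enough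
to pass to the limit in the weak equation: the gradients converge in `L¹`, also when paired with
the flux `|g|^{p-2} g`. -/
structure IsTestApprox (Ω : Set (E n)) (p v : E n → ℝ) (g : E n → E n) (φ : ℕ → E n → ℝ) :
    Prop where
  isTest : ∀ k, IsTest ∞ Ω (φ k)
  tendsto_ae : ∀ᵐ x ∂(volume.restrict Ω), Tendsto (fun k => φ k x) atTop (𝓝 (v x))
  tendsto_lintegral_gradient :
    Tendsto (fun k => ∫⁻ x in Ω, ‖gradient (φ k) x - g x‖ₑ) atTop (𝓝 0)
  tendsto_lintegral_flux : Tendsto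
    (fun k => ∫⁻ x in Ω, ‖inner ℝ (pFlux (p x) (g x)) (gradient (φ k) x - g x)‖ₑ) atTop (𝓝 0)

theorem MemVZero.exists_seq_tendsto (h : MemVZero Ω p v g) :
    ∃ φ : ℕ → E n → ℝ, (∀ k, IsTest ∞ Ω (φ k)) ∧
      Tendsto (fun k => eLpNorm (φ k - v) 2 (volume.restrict Ω)) atTop (𝓝 0) ∧
      Tendsto (fun k => luxNorm (volume.restrict Ω) p fun x => g x - gradient (φ k) x)
        atTop (𝓝 0) := by
  have hε : Tendsto (fun k : ℕ => ((k : ℝ≥0∞) + 1)⁻¹) atTop (𝓝 0) := by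
    simpa only [Nat.cast_add, Nat.cast_one] using
      (tendsto_add_atTop_iff_nat 1).2 ENNReal.tendsto_inv_nat_nhds_zero
  choose φ hφ hlt using fun k : ℕ => h.2 ((k : ℝ≥0∞) + 1)⁻¹ (by simp)
  refine ⟨φ, hφ, tendsto_of_tendsto_of_tendsto_of_le_of_le tendsto_const_nhds hε
    (fun _ => zero_le) fun k => ?_, tendsto_of_tendsto_of_tendsto_of_le_of_le tendsto_const_nhds hε
    (fun _ => zero_le) fun k => le_add_self.trans (hlt k).le⟩
  rw [eLpNorm_sub_comm]
  exact le_self_add.trans (hlt k).le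

theorem MemVZero.exists_isTestApprox [IsFiniteMeasure (volume.restrict Ω)]
    (hp : ∀ᵐ x ∂(volume.restrict Ω), 1 ≤ p x) (h : MemVZero Ω p v g) :
    ∃ φ, IsTestApprox Ω p v g φ := by
  obtain ⟨φ, hφ, hL2, hlux⟩ := h.exists_seq_tendsto
  have hφm : ∀ k, AEStronglyMeasurable (φ k) (volume.restrict Ω) := fun k =>
    (hφ k).1.continuous.aestronglyMeasurable
  obtain ⟨ns, hns, hae⟩ := (tendstoInMeasure_of_tendsto_eLpNorm two_ne_zero hφm
    h.1.aestronglyMeasurable hL2).exists_seq_tendsto_ae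
  replace hlux := hlux.comp hns.tendsto_atTop
  have hweighted := tendsto_lintegral_rpow_sub_one_mul_of_luxNorm hp
    (fun x => norm_nonneg (g x)) h.1.2.2 hlux
  refine ⟨fun k => φ (ns k), fun k => hφ _, hae, ?_, ?_⟩
  · simpa only [enorm_sub_rev (g _)] using tendsto_lintegral_enorm_of_luxNorm hp hlux
  · refine tendsto_of_tendsto_of_tendsto_of_le_of_le tendsto_const_nhds hweighted
      (fun _ => zero_le) fun k => lintegral_mono fun x => ?_
    rw [← ofReal_norm, ← ofReal_norm, norm_sub_rev (g x),
      ← ENNReal.ofReal_mul (by positivity)]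
    refine ENNReal.ofReal_le_ofReal ((norm_inner_le_norm _ _).trans ?_)
    gcongr
    exact norm_pFlux_le _ _

end Approximation

/-! ### Chain rule -/

section ChainRule

variable {Ω : Set (E n)} {p v θ ξ : E n → ℝ} {g : E n → E n}

theorem IsTest.integrableOn_smul {A : E n → E n} (hξ : IsTest ∞ Ω ξ)
    (hA : LocallyIntegrableOn A Ω) : IntegrableOn (fun x => ξ x • A x) Ω := by
  obtain ⟨C, hC⟩ := hξ.exists_bound
  have hint : IntegrableOn (fun x => ξ x • A x) (tsupport ξ) :=
    (hA.integrableOn_compact_subset hξ.2.2 hξ.2.1.isCompact).bdd_smul C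
      hξ.1.continuous.aestronglyMeasurable (Eventually.of_forall hC)
  exact (hint.integrable_of_forall_notMem_eq_zero fun x hx => by
    rw [image_eq_zero_of_notMem_tsupport hx, zero_smul]).restrict

theorem IsWeakGradient.ae_eq {f f' : E n → ℝ} {H H' : E n → E n} (hΩ : IsOpen Ω)
    (hH : IsWeakGradient Ω f H) (hH' : IsWeakGradient Ω f' H') (hf : f =ᵐ[volume.restrict Ω] f') :
    H =ᵐ[volume.restrict Ω] H' := by
  have hzero := hΩ.ae_eq_zero_of_integral_contDiff_smul_eq_zero (hH.2.1.sub hH'.2.1)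
    fun ξ hsmooth hcompact hsub => ?_
  · rw [EventuallyEq, ae_restrict_iff' hΩ.measurableSet]
    filter_upwards [hzero] with x hx hxΩ using sub_eq_zero.1 (hx hxΩ)
  · have hξ : IsTest ∞ Ω ξ := ⟨hsmooth, hcompact, hsub⟩
    have heq : ∫ x in Ω, ξ x • H x = ∫ x in Ω, ξ x • H' x := by
      rw [← neg_inj, ← hH.2.2 ξ hξ, ← hH'.2.2 ξ hξ]
      exact integral_congr_ae (hf.mono fun x hx => by simp only [hx])
    rw [← setIntegral_eq_integral_of_forall_compl_eq_zero (s := Ω)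
      (fun x hx => by rw [hξ.eq_zero hx, zero_smul])]
    simp only [Pi.sub_apply, smul_sub]
    rw [integral_sub (hξ.integrableOn_smul hH.2.1) (hξ.integrableOn_smul hH'.2.1), heq, sub_self]

theorem integrableOn_smul_of_hasCompactSupport {a : E n → ℝ} {V : E n → E n} (ha : Continuous a)
    (hV : Continuous V) (hs : HasCompactSupport V) : IntegrableOn (fun x => a x • V x) Ω :=
  ((ha.smul hV).integrable_of_hasCompactSupport hs.smul_left).restrict

theorem IsTest.integrableOn_gradient (hθ : IsTest 1 Ω θ) : IntegrableOn (gradient θ) Ω :=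
  ((continuous_gradient hθ.1).integrable_of_hasCompactSupport
    hθ.hasCompactSupport_gradient).restrict

variable {F : ℝ → ℝ} {B L : ℝ}

theorem IsTest.setIntegral_comp_mul_smul_gradient {φ : E n → ℝ} (hφ : IsTest 1 Ω φ)
    (hF : ContDiff ℝ 1 F) (hθ : IsTest 1 Ω θ) (hξ : IsTest 1 Ω ξ) :
    ∫ x in Ω, (F (φ x) * θ x) • gradient ξ x =
      -((∫ x in Ω, (ξ x * F (φ x)) • gradient θ x) +
        ∫ x in Ω, (ξ x * θ x * deriv F (φ x)) • gradient φ x) := by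
  have hFφ : ContDiff ℝ 1 fun x => F (φ x) := hF.comp hφ.1
  have hF' : Continuous (deriv F) := hF.continuous_deriv le_rfl
  rw [setIntegral_smul_gradient (hFφ.mul hθ.1) hξ, ← integral_add]
  · congr 2
    ext1 x
    rw [gradient_mul (hFφ.differentiable one_ne_zero x) (hθ.1.differentiable one_ne_zero x),
      gradient_comp (hF.differentiable one_ne_zero _) (hφ.1.differentiable one_ne_zero x),
      smul_add, smul_smul, smul_smul, smul_smul]
  · exact integrableOn_smul_of_hasCompactSupport (hξ.1.continuous.mul hFφ.continuous)
      (continuous_gradient hθ.1) hθ.hasCompactSupport_gradient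
  · exact integrableOn_smul_of_hasCompactSupport
      ((hξ.1.continuous.mul hθ.1.continuous).mul (hF'.comp hφ.1.continuous))
      (continuous_gradient hφ.1) hφ.hasCompactSupport_gradient

theorem IsTestApprox.aestronglyMeasurable {φ : ℕ → E n → ℝ} (h : IsTestApprox Ω p v g φ) :
    AEStronglyMeasurable v (volume.restrict Ω) :=
  aestronglyMeasurable_of_tendsto_ae _ (fun k => (h.isTest k).1.continuous.aestronglyMeasurable)
    h.tendsto_ae

theorem IsTestApprox.tendsto_setIntegral_smul {V : Type*} [NormedAddCommGroup V] [NormedSpace ℝ V]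
    {φ : ℕ → E n → ℝ} (h : IsTestApprox Ω p v g φ) {a : ℝ → E n → ℝ} {C : ℝ}
    (ha : Continuous fun z : ℝ × E n => a z.1 z.2) (hC : ∀ s x, |a s x| ≤ C)
    {f : ℕ → E n → V} {f' : E n → V} (hf : ∀ k, AEStronglyMeasurable (f k) (volume.restrict Ω))
    (hf' : IntegrableOn f' Ω)
    (hlim : Tendsto (fun k => ∫⁻ x in Ω, ‖f k x - f' x‖ₑ) atTop (𝓝 0)) :
    Tendsto (fun k => ∫ x in Ω, a (φ k x) x • f k x) atTop (𝓝 (∫ x in Ω, a (v x) x • f' x)) := by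
  refine tendsto_integral_smul_of_bounded_of_tendsto_lintegral
    (fun k => (ha.comp ((h.isTest k).1.continuous.prodMk continuous_id)).aestronglyMeasurable)
    (fun k => Eventually.of_forall fun x => hC _ x) ?_ hf hf' hlim
  filter_upwards [h.tendsto_ae] with x hx
  exact (ha.tendsto (v x, x)).comp (hx.prodMk_nhds tendsto_const_nhds)

theorem IsTestApprox.integrableOn_weakGradient_comp_mul {φ : ℕ → E n → ℝ}
    (h : IsTestApprox Ω p v g φ) (hg : IntegrableOn g Ω) (hF : ContDiff ℝ 1 F)
    (hB : ∀ s, |F s| ≤ B) (hL : ∀ s, |deriv F s| ≤ L) (hθ : IsTest 1 Ω θ) :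
    IntegrableOn (fun x => F (v x) • gradient θ x) Ω ∧
      IntegrableOn (fun x => (θ x * deriv F (v x)) • g x) Ω := by
  obtain ⟨Cθ, hCθ⟩ := hθ.exists_bound
  constructor
  · exact hθ.integrableOn_gradient.bdd_smul B
      (hF.continuous.comp_aestronglyMeasurable h.aestronglyMeasurable)
      (Eventually.of_forall fun x => hB _)
  · refine hg.bdd_smul (Cθ * L) (hθ.1.continuous.aestronglyMeasurable.mul
      ((hF.continuous_deriv le_rfl).comp_aestronglyMeasurable h.aestronglyMeasurable))
      (Eventually.of_forall fun x => ?_)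
    rw [Pi.mul_apply, norm_mul]
    exact mul_le_mul (hCθ x) (hL _) (norm_nonneg _) ((abs_nonneg _).trans (hCθ x))

theorem IsTestApprox.setIntegral_comp_mul_smul_gradient {φ : ℕ → E n → ℝ}
    (h : IsTestApprox Ω p v g φ) (hg : IntegrableOn g Ω) (hF : ContDiff ℝ 1 F)
    (hB : ∀ s, |F s| ≤ B) (hL : ∀ s, |deriv F s| ≤ L) (hθ : IsTest 1 Ω θ) (hξ : IsTest 1 Ω ξ) :
    ∫ x in Ω, (F (v x) * θ x) • gradient ξ x =
      -((∫ x in Ω, (ξ x * F (v x)) • gradient θ x) +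
        ∫ x in Ω, (ξ x * θ x * deriv F (v x)) • g x) := by
  obtain ⟨Cθ, hCθ⟩ := hθ.exists_bound
  obtain ⟨Cξ, hCξ⟩ := hξ.exists_bound
  have hF' : Continuous (deriv F) := hF.continuous_deriv le_rfl
  have hbound : ∀ {a b C D : ℝ}, |a| ≤ C → |b| ≤ D → |a * b| ≤ C * D := fun ha hb => by
    rw [abs_mul]
    exact mul_le_mul ha hb (abs_nonneg _) ((abs_nonneg _).trans ha)
  have hlim₁ := h.tendsto_setIntegral_smul (a := fun s x => F s * θ x)
    ((hF.continuous.comp continuous_fst).mul (hθ.1.continuous.comp continuous_snd))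
    (fun s x => hbound (hB s) (hCθ x)) (fun _ => hξ.integrableOn_gradient.1)
    hξ.integrableOn_gradient (by simp)
  have hlim₂ := h.tendsto_setIntegral_smul (a := fun s x => ξ x * F s)
    ((hξ.1.continuous.comp continuous_snd).mul (hF.continuous.comp continuous_fst))
    (fun s x => hbound (hCξ x) (hB s)) (fun _ => hθ.integrableOn_gradient.1)
    hθ.integrableOn_gradient (by simp)
  have hlim₃ := h.tendsto_setIntegral_smul (a := fun s x => ξ x * θ x * deriv F s)
    (((hξ.1.continuous.mul hθ.1.continuous).comp continuous_snd).mul (hF'.comp continuous_fst))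
    (fun s x => hbound (hbound (hCξ x) (hCθ x)) (hL s))
    (fun k => (continuous_gradient ((h.isTest k).1.of_le (by simp))).aestronglyMeasurable) hg
    h.tendsto_lintegral_gradient
  refine tendsto_nhds_unique hlim₁ ((hlim₂.add hlim₃).neg.congr fun k => ?_)
  exact (((h.isTest k).of_le (by simp)).setIntegral_comp_mul_smul_gradient hF hθ hξ).symm

theorem IsTestApprox.isWeakGradient_comp_mul {φ : ℕ → E n → ℝ}
    (h : IsTestApprox Ω p v g φ) (hg : IntegrableOn g Ω) (hF : ContDiff ℝ 1 F)
    (hB : ∀ s, |F s| ≤ B) (hL : ∀ s, |deriv F s| ≤ L) (hθ : IsTest 1 Ω θ) :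
    IsWeakGradient Ω (fun x => F (v x) * θ x)
      (fun x => F (v x) • gradient θ x + (θ x * deriv F (v x)) • g x) := by
  obtain ⟨hi₁, hi₂⟩ := h.integrableOn_weakGradient_comp_mul hg hF hB hL hθ
  have hFv : AEStronglyMeasurable (fun x => F (v x)) (volume.restrict Ω) :=
    hF.continuous.comp_aestronglyMeasurable h.aestronglyMeasurable
  refine ⟨IntegrableOn.locallyIntegrableOn ?_, (hi₁.add hi₂).locallyIntegrableOn, fun ξ hξ => ?_⟩
  · exact (hθ.1.continuous.integrable_of_hasCompactSupport hθ.2.1).restrict.bdd_mul (c := B) hFv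
      (Eventually.of_forall fun x => hB _)
  · rw [h.setIntegral_comp_mul_smul_gradient hg hF hB hL hθ (hξ.of_le (by simp))]
    simp only [smul_add, mul_smul]
    rw [integral_add (hξ.integrableOn_smul hi₁.locallyIntegrableOn)
      (by simpa only [mul_smul, IntegrableOn] using
        hξ.integrableOn_smul hi₂.locallyIntegrableOn)]

theorem exists_isTest_eq_rpow {m : ℝ} (hm : 1 ≤ m) (M : ℝ) :
    ∃ F : ℝ → ℝ, IsTest 1 univ F ∧
      ∀ s ∈ Icc 0 M, F s = s ^ m ∧ deriv F s = m * s ^ (m - 1) := by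
  set f : ℝ → ℝ := fun s => m * (max 0 s) ^ (m - 1)
  have hf : Continuous f :=
    continuous_const.mul (Continuous.rpow_const (by fun_prop) fun s => Or.inr (by linarith))
  have hderiv : ∀ s, HasDerivAt (fun s => ∫ r in 0..s, f r) (f s) s := fun s =>
    (hf.integral_hasStrictDerivAt 0 s).hasDerivAt
  have hfs : ∀ s, 0 ≤ s → f s = m * s ^ (m - 1) := fun s hs => by
    simp only [f, max_eq_right hs]
  have hprim : ∀ s, 0 ≤ s → ∫ r in 0..s, f r = s ^ m := fun s hs => by
    rw [intervalIntegral.integral_congr (g := fun r => m * r ^ (m - 1)) fun r hr => hfs r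
        (uIcc_of_le hs ▸ hr).1, intervalIntegral.integral_const_mul,
      integral_rpow (Or.inl (by linarith)), sub_add_cancel, Real.zero_rpow (by linarith), sub_zero,
      mul_div_cancel₀ _ (by linarith)]
  let χ : ContDiffBump (0 : ℝ) := ⟨|M| + 1, |M| + 2, by positivity, by linarith⟩
  refine ⟨fun s => χ s * ∫ r in 0..s, f r, ⟨χ.contDiff.mul ?_, χ.hasCompactSupport.mul_right,
    subset_univ _⟩, fun s hs => ?_⟩
  · refine contDiff_one_iff_deriv.2 ⟨fun s => (hderiv s).differentiableAt, ?_⟩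
    rwa [funext fun s => (hderiv s).deriv]
  · have hone : χ =ᶠ[𝓝 s] 1 := χ.eventuallyEq_one_of_mem_ball <| by
      rw [mem_ball_zero_iff, Real.norm_of_nonneg hs.1]
      exact lt_add_of_le_of_pos (hs.2.trans (le_abs_self M)) one_pos
    have heq : (fun s => χ s * ∫ r in 0..s, f r) =ᶠ[𝓝 s] fun s => ∫ r in 0..s, f r :=
      hone.mono fun r hr => by simp only [hr, Pi.one_apply, one_mul]
    exact ⟨heq.eq_of_nhds.trans (hprim s hs.1), by
      rw [heq.deriv_eq, (hderiv s).deriv, hfs s hs.1]⟩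

theorem IsTestApprox.weakGradient_rpow_mul_ae_eq {φ : ℕ → E n → ℝ} (hΩ : IsOpen Ω)
    (h : IsTestApprox Ω p v g φ) (hg : IntegrableOn g Ω) {m M : ℝ} (hm : 1 ≤ m)
    (hv : ∀ᵐ x ∂(volume.restrict Ω), v x ∈ Icc 0 M) (hθ : IsTest 1 Ω θ) {H : E n → E n}
    (hH : IsWeakGradient Ω (fun x => v x ^ m * θ x) H) :
    H =ᵐ[volume.restrict Ω] fun x =>
      v x ^ m • gradient θ x + (θ x * (m * v x ^ (m - 1))) • g x := by
  obtain ⟨F, hF, hFm⟩ := exists_isTest_eq_rpow hm M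
  obtain ⟨B, hB⟩ := hF.exists_bound
  obtain ⟨L, hL⟩ := hF.2.1.deriv.exists_bound_of_continuous (hF.1.continuous_deriv le_rfl)
  have hK := h.isWeakGradient_comp_mul hg hF.1 hB hL hθ
  refine (hH.ae_eq hΩ hK (hv.mono fun x hx => ?_)).trans (hv.mono fun x hx => ?_)
  · simp only [(hFm _ hx).1]
  · simp only [(hFm _ hx).1, (hFm _ hx).2]

end ChainRule

/-! ### Equations in divergence form -/

section Divergence

variable {Ω : Set (E n)} {θ : E n → ℝ}

/-- The equation `div A = b` on `Ω` in the sense of distributions. -/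
def IsWeakDivergence (Ω : Set (E n)) (A : E n → E n) (b : E n → ℝ) : Prop :=
  ∀ θ : E n → ℝ, IsTest ∞ Ω θ → ∫ x in Ω, (b x * θ x + inner ℝ (A x) (gradient θ x)) = 0

theorem IsTest.integrable_mul_add_inner_gradient {X : Type*} [MeasurableSpace X] {μ : Measure X}
    (hθ : IsTest 1 Ω θ) {f : X → E n} (hf : Measurable f) {b : X → ℝ} {A : X → E n}
    (hb : Integrable b μ) (hA : Integrable A μ) :
    Integrable (fun z => b z * θ (f z) + inner ℝ (A z) (gradient θ (f z))) μ := by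
  obtain ⟨C, hC⟩ := hθ.exists_bound
  obtain ⟨D, hD⟩ := hθ.exists_gradient_bound
  exact (hb.mul_bdd (c := C) (hθ.1.continuous.measurable.comp hf).aestronglyMeasurable
      (Eventually.of_forall fun z => hC _)).add
    (integrable_inner_of_bounded hA
      ((continuous_gradient hθ.1).measurable.comp hf).aestronglyMeasurable
      (Eventually.of_forall fun z => hD _))

theorem exists_countable_dense_isTest (hΩ : Bornology.IsBounded Ω) :
    ∃ D : Set (E n → ℝ), D.Countable ∧ (∀ d ∈ D, IsTest ∞ Ω d) ∧
      ∀ θ, IsTest ∞ Ω θ → ∀ ε > 0, ∃ d ∈ D, ∀ x ∈ Ω,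
        |θ x - d x| ≤ ε ∧ ‖gradient θ x - gradient d x‖ ≤ ε := by
  have : CompactSpace (closure Ω) := isCompact_iff_compactSpace.1 hΩ.isCompact_closure
  -- The `C¹` topology, induced from the separable space of continuous maps on `closure Ω`.
  let J : {θ : E n → ℝ // IsTest ∞ Ω θ} → C(closure Ω, ℝ × E n) := fun θ =>
    ⟨fun x => (θ.1 x, gradient θ.1 x), (θ.2.1.continuous.comp continuous_subtype_val).prodMk
      ((continuous_gradient (θ.2.1.of_le (by simp))).comp continuous_subtype_val)⟩
  let _ : TopologicalSpace {θ : E n → ℝ // IsTest ∞ Ω θ} := TopologicalSpace.induced J inferInstance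
  have : SecondCountableTopology {θ : E n → ℝ // IsTest ∞ Ω θ} :=
    TopologicalSpace.secondCountableTopology_induced _ _ J
  have hJ : Continuous J := continuous_induced_dom
  obtain ⟨D, hcountable, hdense⟩ :=
    TopologicalSpace.exists_countable_dense {θ : E n → ℝ // IsTest ∞ Ω θ}
  refine ⟨Subtype.val '' D, hcountable.image _, ?_, fun θ hθ ε hε => ?_⟩
  · rintro _ ⟨d, -, rfl⟩
    exact d.2
  · obtain ⟨d, hd, hdD⟩ := hdense.inter_open_nonempty _
      (Metric.isOpen_ball.preimage hJ : IsOpen (J ⁻¹' Metric.ball (J ⟨θ, hθ⟩) ε))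
      ⟨⟨θ, hθ⟩, Metric.mem_ball_self hε⟩
    refine ⟨d.1, mem_image_of_mem _ hdD, fun x hx => ?_⟩
    have hdist := (ContinuousMap.dist_lt_iff hε).1 hd ⟨x, subset_closure hx⟩
    rw [dist_comm, Prod.dist_eq, max_lt_iff, Real.dist_eq, dist_eq_norm] at hdist
    exact ⟨hdist.1.le, hdist.2.le⟩

theorem IsWeakDivergence.of_dense (hΩ : MeasurableSet Ω) {A : E n → E n} {b : E n → ℝ}
    (hA : IntegrableOn A Ω) (hb : IntegrableOn b Ω) {D : Set (E n → ℝ)}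
    (hD : ∀ d ∈ D, IsTest ∞ Ω d)
    (hdense : ∀ θ, IsTest ∞ Ω θ → ∀ ε > 0, ∃ d ∈ D, ∀ x ∈ Ω,
      |θ x - d x| ≤ ε ∧ ‖gradient θ x - gradient d x‖ ≤ ε)
    (h : ∀ d ∈ D, ∫ x in Ω, (b x * d x + inner ℝ (A x) (gradient d x)) = 0) :
    IsWeakDivergence Ω A b := by
  intro θ hθ
  have hint : ∀ {θ}, IsTest ∞ Ω θ →
      IntegrableOn (fun x => b x * θ x + inner ℝ (A x) (gradient θ x)) Ω := fun hθ =>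
    (hθ.of_le (by simp)).integrable_mul_add_inner_gradient measurable_id hb hA
  set I : ℝ := ∫ x in Ω, (‖b x‖ + ‖A x‖)
  have hle : ∀ ε > 0, |∫ x in Ω, (b x * θ x + inner ℝ (A x) (gradient θ x))| ≤ ε * I := by
    intro ε hε
    obtain ⟨d, hd, hdist⟩ := hdense θ hθ ε hε
    rw [← sub_zero (∫ x in Ω, _), ← h d hd, ← integral_sub (hint hθ) (hint (hD d hd)),
      ← Real.norm_eq_abs, ← integral_const_mul]
    refine norm_integral_le_of_norm_le ((hb.norm.add hA.norm).const_mul ε) ?_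
    filter_upwards [ae_restrict_mem hΩ] with x hx
    obtain ⟨hval, hgrad⟩ := hdist x hx
    calc ‖b x * θ x + inner ℝ (A x) (gradient θ x) - (b x * d x + inner ℝ (A x) (gradient d x))‖
        = ‖b x * (θ x - d x) + inner ℝ (A x) (gradient θ x - gradient d x)‖ := by
          rw [inner_sub_right, mul_sub, add_sub_add_comm]
      _ ≤ ‖b x‖ * |θ x - d x| + ‖A x‖ * ‖gradient θ x - gradient d x‖ :=
          (norm_add_le _ _).trans (add_le_add (norm_mul _ _).le (norm_inner_le_norm _ _))
      _ ≤ ‖b x‖ * ε + ‖A x‖ * ε := by gcongr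
      _ = ε * (‖b x‖ + ‖A x‖) := by ring
  have hlim : Tendsto (fun ε : ℝ => ε * I) (𝓝[>] 0) (𝓝 0) := by
    simpa only [zero_mul] using
      ((continuous_mul_const I).tendsto 0).mono_left nhdsWithin_le_nhds
  exact abs_nonpos_iff.1 (ge_of_tendsto hlim (eventually_mem_nhdsWithin.mono hle))

theorem ae_integral_slice_eq_zero {X : Type*} [MeasurableSpace X] {μ : Measure X} [SFinite μ]
    {J : Set ℝ} (hJ : IsOpen J) {f : X × ℝ → ℝ} (hf : Integrable f (μ.prod (volume.restrict J)))
    (h : ∀ χ, IsTest ∞ J χ → ∫ z, χ z.2 * f z ∂(μ.prod (volume.restrict J)) = 0) :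
    ∀ᵐ t ∂(volume.restrict J), ∫ x, f (x, t) ∂μ = 0 := by
  rw [ae_restrict_iff' hJ.measurableSet]
  refine hJ.ae_eq_zero_of_integral_contDiff_smul_eq_zero
    (IntegrableOn.locallyIntegrableOn hf.integral_prod_right) fun χ hsmooth hcompact hsub => ?_
  have hχ : IsTest ∞ J χ := ⟨hsmooth, hcompact, hsub⟩
  obtain ⟨C, hC⟩ := hχ.exists_bound
  have hχf := h χ hχ
  rw [integral_prod_symm _ (hf.bdd_mul (f := fun z => χ z.2) (c := C)
    (hsmooth.continuous.measurable.comp measurable_snd).aestronglyMeasurable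
    (Eventually.of_forall fun z => hC z.2))] at hχf
  rw [← setIntegral_eq_integral_of_forall_compl_eq_zero (s := J)
    (fun x hx => by rw [hχ.eq_zero hx, zero_smul])]
  simpa only [smul_eq_mul, ← integral_const_mul] using hχf

theorem ae_isWeakDivergence_slice (hΩ : MeasurableSet Ω) (hΩb : Bornology.IsBounded Ω) {J : Set ℝ}
    (hJ : IsOpen J) {A : E n × ℝ → E n} {b : E n × ℝ → ℝ}
    (hA : Integrable A ((volume.restrict Ω).prod (volume.restrict J)))
    (hb : Integrable b ((volume.restrict Ω).prod (volume.restrict J)))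
    (h : ∀ θ, IsTest ∞ Ω θ → ∀ χ, IsTest ∞ J χ →
      ∫ z, χ z.2 * (b z * θ z.1 + inner ℝ (A z) (gradient θ z.1))
        ∂((volume.restrict Ω).prod (volume.restrict J)) = 0) :
    ∀ᵐ t ∂(volume.restrict J), IsWeakDivergence Ω (fun x => A (x, t)) fun x => b (x, t) := by
  obtain ⟨D, hcountable, hD, hdense⟩ := exists_countable_dense_isTest hΩb
  have hslice : ∀ᵐ t ∂(volume.restrict J), ∀ d ∈ D,
      ∫ x in Ω, (b (x, t) * d x + inner ℝ (A (x, t)) (gradient d x)) = 0 :=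
    (ae_ball_iff hcountable).2 fun d hd => ae_integral_slice_eq_zero hJ
      (((hD d hd).of_le (by simp)).integrable_mul_add_inner_gradient measurable_fst hb hA)
      (h d (hD d hd))
  filter_upwards [hslice, hA.prod_left_ae, hb.prod_left_ae] with t ht hAt hbt
  exact IsWeakDivergence.of_dense hΩ hAt hbt hD hdense ht

end Divergence

/-! ### Weak solutions on time slices -/

theorem integrable_rpow_smul {X F : Type*} [MeasurableSpace X] {μ : Measure X}
    [NormedAddCommGroup F] [NormedSpace ℝ F] {u : X → ℝ} {f : X → F} {s M : ℝ} (hs : 0 ≤ s)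
    (hu : AEMeasurable u μ) (hM : ∀ᵐ x ∂μ, u x ∈ Icc 0 M) (hf : Integrable f μ) :
    Integrable (fun x => u x ^ s • f x) μ := by
  refine hf.bdd_smul (M ^ s) (hu.pow_const s).aestronglyMeasurable ?_
  filter_upwards [hM] with x hx
  rw [Real.norm_of_nonneg (Real.rpow_nonneg hx.1 s)]
  exact Real.rpow_le_rpow hx.1 hx.2 hs

theorem integrable_pFlux {X F : Type*} [MeasurableSpace X] {μ : Measure X} [IsFiniteMeasure μ]
    [NormedAddCommGroup F] [InnerProductSpace ℝ F] {q : X → ℝ} {g : X → F} (hqm : AEMeasurable q μ)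
    (hq : ∀ᵐ x ∂μ, 1 ≤ q x) (hg : AEStronglyMeasurable g μ)
    (hgi : Integrable (fun x => ‖g x‖ ^ q x) μ) : Integrable (fun x => pFlux (q x) (g x)) μ := by
  refine ((integrable_const (1 : ℝ)).add hgi).mono' (aestronglyMeasurable_pFlux hqm hg) ?_
  filter_upwards [hq] with x hx using norm_pFlux_le_one_add hx _

theorem IsTest.mul_const {Ω : Set (E n)} {θ : E n → ℝ} {k : WithTop ℕ∞} (hθ : IsTest k Ω θ)
    (c : ℝ) : IsTest k Ω fun x => θ x * c :=
  ⟨hθ.1.mul contDiff_const, hθ.2.1.mul_right, tsupport_mul_subset_left.trans hθ.2.2⟩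

theorem IsTest.mul_time {Ω : Set (E n)} {T : ℝ} {θ : E n → ℝ} {χ : ℝ → ℝ} {k : WithTop ℕ∞}
    (hθ : IsTest k Ω θ) (hχ : IsTest k (Ioo 0 T) χ) :
    IsTest k (cylinder Ω T) fun z => θ z.1 * χ z.2 := by
  have hsub : (Function.support fun z : E n × ℝ => θ z.1 * χ z.2) ⊆ tsupport θ ×ˢ tsupport χ :=
    fun z hz => ⟨subset_tsupport _ (left_ne_zero_of_mul hz),
      subset_tsupport _ (right_ne_zero_of_mul hz)⟩
  refine ⟨(hθ.1.comp contDiff_fst).mul (hχ.1.comp contDiff_snd),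
    HasCompactSupport.of_support_subset_isCompact (hθ.2.1.isCompact.prod hχ.2.1.isCompact) hsub, ?_⟩
  exact (closure_minimal hsub ((isClosed_tsupport _).prod (isClosed_tsupport _))).trans
    (prod_mono hθ.2.2 hχ.2.2)

theorem restrict_cylinder (Ω : Set (E n)) (T : ℝ) :
    (volume : Measure (E n × ℝ)).restrict (cylinder Ω T) =
      (volume.restrict Ω).prod (volume.restrict (Ioo 0 T)) := by
  rw [cylinder, Measure.prod_restrict, Measure.volume_eq_prod]

namespace IsWeakSolutionWith

variable {Ω : Set (E n)} {T : ℝ} {p : E n → ℝ} {m : ℝ} {u₀ : E n → ℝ} {u : E n × ℝ → ℝ}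
  {G : E n × ℝ → E n} {w : E n × ℝ → ℝ} {θ : E n → ℝ} {χ : ℝ → ℝ}

theorem aemeasurable (hu : IsWeakSolutionWith Ω T p m u₀ u G w) :
    AEMeasurable u ((volume.restrict Ω).prod (volume.restrict (Ioo 0 T))) :=
  restrict_cylinder Ω T ▸ hu.memLinfty.aestronglyMeasurable.aemeasurable

theorem aestronglyMeasurable_gradient (hu : IsWeakSolutionWith Ω T p m u₀ u G w) :
    AEStronglyMeasurable G ((volume.restrict Ω).prod (volume.restrict (Ioo 0 T))) :=
  restrict_cylinder Ω T ▸ hu.memU.2.1.1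

theorem integrable_rpow_gradient (hu : IsWeakSolutionWith Ω T p m u₀ u G w) :
    Integrable (fun z => ‖G z‖ ^ p z.1) ((volume.restrict Ω).prod (volume.restrict (Ioo 0 T))) :=
  restrict_cylinder Ω T ▸ hu.memU.2.2.2

theorem integrable_timeDeriv [IsFiniteMeasure (volume.restrict Ω)]
    (hu : IsWeakSolutionWith Ω T p m u₀ u G w) :
    Integrable w ((volume.restrict Ω).prod (volume.restrict (Ioo 0 T))) := by
  have hw := hu.timeDeriv_memL2
  rw [restrict_cylinder] at hw
  exact hw.integrable one_le_two

theorem exists_ae_mem_Icc (hu : IsWeakSolutionWith Ω T p m u₀ u G w) :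
    ∃ M, 0 ≤ M ∧ ∀ᵐ z ∂((volume.restrict Ω).prod (volume.restrict (Ioo 0 T))), u z ∈ Icc 0 M := by
  have hnonneg := hu.nonneg
  have hLinfty := hu.memLinfty
  rw [restrict_cylinder] at hnonneg hLinfty
  have htop := hLinfty.2
  rw [eLpNorm_exponent_top] at htop
  refine ⟨(eLpNormEssSup u ((volume.restrict Ω).prod (volume.restrict (Ioo 0 T)))).toReal,
    ENNReal.toReal_nonneg, ?_⟩
  filter_upwards [hnonneg, ae_le_eLpNormEssSup (f := u)] with z hz hzle
  refine ⟨hz, (le_abs_self _).trans ?_⟩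
  simpa only [toReal_enorm, Real.norm_eq_abs] using ENNReal.toReal_mono htop.ne hzle

theorem spatialGradient_rpow_mul_ae_eq [IsFiniteMeasure (volume.restrict Ω)] (hΩ : IsOpen Ω)
    (hp : ∀ᵐ x ∂(volume.restrict Ω), 1 ≤ p x) (hm : 1 ≤ m)
    (hu : IsWeakSolutionWith Ω T p m u₀ u G w) (hθ : IsTest 1 Ω θ) (hχ : Continuous χ)
    {H : E n × ℝ → E n} (hH : IsSpatialGradient Ω T (fun z => u z ^ m * (θ z.1 * χ z.2)) H) :
    H =ᵐ[(volume.restrict Ω).prod (volume.restrict (Ioo 0 T))] fun z =>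
      χ z.2 • (u z ^ m • gradient θ z.1 + (θ z.1 * (m * u z ^ (m - 1))) • G z) := by
  obtain ⟨M, -, hM⟩ := hu.exists_ae_mem_Icc
  have hθm : Measurable fun z : E n × ℝ => θ z.1 :=
    hθ.1.continuous.measurable.comp measurable_fst
  have hgθm : Measurable fun z : E n × ℝ => gradient θ z.1 :=
    (continuous_gradient hθ.1).measurable.comp measurable_fst
  have hχm : Measurable fun z : E n × ℝ => χ z.2 := hχ.measurable.comp measurable_snd
  refine ae_eq_prod_of_ae_ae_swap (restrict_cylinder Ω T ▸ hH.1) (hχm.aestronglyMeasurable.smul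
    (((hu.aemeasurable.pow_const _).aestronglyMeasurable.smul hgθm.aestronglyMeasurable).add
      ((hθm.aestronglyMeasurable.mul
        ((hu.aemeasurable.pow_const _).const_mul m).aestronglyMeasurable).smul
          hu.aestronglyMeasurable_gradient))) ?_
  filter_upwards [hH.2, hu.lateralTrace, ae_ae_swap_of_ae_prod hM] with t hHt hut hMt
  obtain ⟨φ, hφ⟩ := hut.exists_isTestApprox hp
  filter_upwards [hφ.weakGradient_rpow_mul_ae_eq hΩ (hut.1.integrable_gradient hp) hm hMt
    (hθ.mul_const (χ t)) hHt] with x hx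
  rw [hx, gradient_mul (hθ.1.differentiable one_ne_zero x) (differentiableAt_const _),
    gradient_fun_const, smul_zero, zero_add]
  module

theorem integrable_source (hm : 1 ≤ m)
    (hu : IsWeakSolutionWith Ω T p m u₀ u G w) :
    Integrable (fun z => m * u z ^ (m - 1) * ‖G z‖ ^ p z.1)
      ((volume.restrict Ω).prod (volume.restrict (Ioo 0 T))) := by
  obtain ⟨M, -, hM⟩ := hu.exists_ae_mem_Icc
  simpa only [smul_eq_mul, mul_assoc] using (integrable_rpow_smul (sub_nonneg.2 hm)
    hu.aemeasurable hM hu.integrable_rpow_gradient).const_mul m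

theorem integrable_rpow_smul_pFlux [IsFiniteMeasure (volume.restrict Ω)]
    (hpm : AEMeasurable p (volume.restrict Ω)) (hp : ∀ᵐ x ∂(volume.restrict Ω), 1 ≤ p x)
    (hm : 0 ≤ m) (hu : IsWeakSolutionWith Ω T p m u₀ u G w) :
    Integrable (fun z => u z ^ m • pFlux (p z.1) (G z))
      ((volume.restrict Ω).prod (volume.restrict (Ioo 0 T))) := by
  obtain ⟨M, -, hM⟩ := hu.exists_ae_mem_Icc
  exact integrable_rpow_smul hm hu.aemeasurable hM
    (integrable_pFlux (hpm.comp_quasiMeasurePreserving Measure.quasiMeasurePreserving_fst)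
      (Measure.quasiMeasurePreserving_fst.ae hp) hu.aestronglyMeasurable_gradient
      hu.integrable_rpow_gradient)

theorem inner_flux_rpow_mul_ae_eq [IsFiniteMeasure (volume.restrict Ω)] (hΩ : IsOpen Ω)
    (hp : ∀ᵐ x ∂(volume.restrict Ω), 1 ≤ p x) (hm : 1 ≤ m)
    (hu : IsWeakSolutionWith Ω T p m u₀ u G w) (hθ : IsTest 1 Ω θ) (hχ : Continuous χ)
    {H : E n × ℝ → E n} (hH : IsSpatialGradient Ω T (fun z => u z ^ m * (θ z.1 * χ z.2)) H) :
    (fun z => ‖G z‖ ^ (p z.1 - 2) * inner ℝ (G z) (H z))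
      =ᵐ[(volume.restrict Ω).prod (volume.restrict (Ioo 0 T))] fun z =>
        χ z.2 * (m * u z ^ (m - 1) * ‖G z‖ ^ p z.1 * θ z.1 +
          inner ℝ (u z ^ m • pFlux (p z.1) (G z)) (gradient θ z.1)) := by
  filter_upwards [hu.spatialGradient_rpow_mul_ae_eq hΩ hp hm hθ hχ hH,
    Measure.quasiMeasurePreserving_fst.ae hp] with z hz hpz
  rw [← real_inner_smul_left, ← pFlux, hz, inner_smul_right, inner_add_right, inner_smul_right,
    inner_smul_right, inner_pFlux_self (by linarith), real_inner_smul_left]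
  ring

theorem integral_mul_slice_eq_zero [IsFiniteMeasure (volume.restrict Ω)] (hΩ : IsOpen Ω)
    (hpm : AEMeasurable p (volume.restrict Ω)) (hp : ∀ᵐ x ∂(volume.restrict Ω), 1 ≤ p x)
    (hm : 1 ≤ m) (hu : IsWeakSolutionWith Ω T p m u₀ u G w) (hθ : IsTest 1 Ω θ)
    (hχ : IsTest 1 (Ioo 0 T) χ) :
    ∫ z, χ z.2 * ((w z + m * u z ^ (m - 1) * ‖G z‖ ^ p z.1) * θ z.1 +
      inner ℝ (u z ^ m • pFlux (p z.1) (G z)) (gradient θ z.1))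
      ∂((volume.restrict Ω).prod (volume.restrict (Ioo 0 T))) = 0 := by
  obtain ⟨H, hH, heq⟩ := hu.weakForm _ (hθ.mul_time hχ)
  rw [restrict_cylinder] at heq
  obtain ⟨C, hC⟩ := (hθ.mul_time hχ).exists_bound
  have htime : Integrable (fun z => w z * (θ z.1 * χ z.2))
      ((volume.restrict Ω).prod (volume.restrict (Ioo 0 T))) :=
    hu.integrable_timeDeriv.mul_bdd (c := C)
      (hθ.mul_time hχ).1.continuous.measurable.aestronglyMeasurable (Eventually.of_forall hC)
  obtain ⟨D, hD⟩ := hχ.exists_bound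
  have hspace := (hθ.integrable_mul_add_inner_gradient measurable_fst (hu.integrable_source hm)
    (hu.integrable_rpow_smul_pFlux hpm hp (zero_le_one.trans hm))).bdd_mul
      (f := fun z => χ z.2) (c := D)
      (hχ.1.continuous.measurable.comp measurable_snd).aestronglyMeasurable
      (Eventually.of_forall fun z => hD z.2)
  rw [integral_congr_ae (hu.inner_flux_rpow_mul_ae_eq hΩ hp hm hθ hχ.1.continuous hH),
    ← integral_add htime hspace] at heq
  refine (integral_congr_ae (Eventually.of_forall fun z => ?_)).trans heq
  ring

theorem ae_isWeakDivergence [IsFiniteMeasure (volume.restrict Ω)] (hΩ : IsOpen Ω)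
    (hΩb : Bornology.IsBounded Ω)
    (hpm : AEMeasurable p (volume.restrict Ω)) (hp : ∀ᵐ x ∂(volume.restrict Ω), 1 ≤ p x)
    (hm : 1 ≤ m) (hu : IsWeakSolutionWith Ω T p m u₀ u G w) :
    ∀ᵐ t ∂(volume.restrict (Ioo 0 T)),
      IsWeakDivergence Ω (fun x => u (x, t) ^ m • pFlux (p x) (G (x, t)))
        fun x => w (x, t) + m * u (x, t) ^ (m - 1) * ‖G (x, t)‖ ^ p x :=
  ae_isWeakDivergence_slice hΩ.measurableSet hΩb isOpen_Ioo
    (hu.integrable_rpow_smul_pFlux hpm hp (zero_le_one.trans hm))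
    (hu.integrable_timeDeriv.add (hu.integrable_source hm)) fun _ hθ _ hχ =>
    hu.integral_mul_slice_eq_zero hΩ hpm hp hm (hθ.of_le (by simp)) (hχ.of_le (by simp))

end IsWeakSolutionWith

/-! ### The entropy -/

section Entropy

variable {N s : ℝ}

/-- The entropy `log (1 + N s²)`; it vanishes at `0` and blows up elsewhere as `N → ∞`. -/
noncomputable def entropy (N s : ℝ) : ℝ := Real.log (1 + N * s ^ 2)

/-- The derivative of the entropy, used as a test function. -/
noncomputable def entropyDeriv (N s : ℝ) : ℝ := 2 * N * s / (1 + N * s ^ 2)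

theorem one_add_mul_sq_pos (hN : 0 ≤ N) (s : ℝ) : 0 < 1 + N * s ^ 2 := by positivity

theorem hasDerivAt_one_add_mul_sq (N s : ℝ) :
    HasDerivAt (fun r => 1 + N * r ^ 2) (2 * N * s) s :=
  ((((hasDerivAt_id s).pow 2).const_mul N).const_add 1).congr_deriv
    (by simp only [id_eq, Nat.cast_ofNat]; ring)

theorem hasDerivAt_entropy (hN : 0 ≤ N) (s : ℝ) :
    HasDerivAt (entropy N) (entropyDeriv N s) s :=
  (hasDerivAt_one_add_mul_sq N s).log (one_add_mul_sq_pos hN s).ne'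

theorem entropy_nonneg {N : ℝ} (hN : 0 ≤ N) (s : ℝ) : 0 ≤ entropy N s :=
  Real.log_nonneg (le_add_of_nonneg_right (by positivity))

theorem entropy_zero (N : ℝ) : entropy N 0 = 0 := by simp [entropy]

theorem tendsto_entropy_atTop (hs : s ≠ 0) :
    Tendsto (fun N : ℕ => entropy N s) atTop atTop :=
  Real.tendsto_log_atTop.comp (tendsto_atTop_add_const_left _ 1
    (tendsto_natCast_atTop_atTop.atTop_mul_const (by positivity)))

theorem contDiff_entropyDeriv (hN : 0 ≤ N) : ContDiff ℝ ∞ (entropyDeriv N) :=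
  (contDiff_const.mul contDiff_id).div (contDiff_const.add (contDiff_const.mul (contDiff_id.pow 2)))
    fun s => (one_add_mul_sq_pos hN s).ne'

theorem deriv_entropyDeriv (hN : 0 ≤ N) (s : ℝ) :
    deriv (entropyDeriv N) s = 2 * N * (1 - N * s ^ 2) / (1 + N * s ^ 2) ^ 2 := by
  have hnum : HasDerivAt (fun r => 2 * N * r) (2 * N) s :=
    ((hasDerivAt_id s).const_mul (2 * N)).congr_deriv (mul_one _)
  refine (hnum.div (hasDerivAt_one_add_mul_sq N s) (one_add_mul_sq_pos hN s).ne').deriv.trans ?_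
  ring

theorem abs_entropyDeriv_le (hN : 0 ≤ N) (s : ℝ) : |entropyDeriv N s| ≤ N + 1 := by
  have hpos := one_add_mul_sq_pos hN s
  rw [entropyDeriv, abs_div, abs_of_pos hpos, div_le_iff₀ hpos, abs_le]
  have hsq := mul_nonneg hN (sq_nonneg (s - 1))
  have hsq' := mul_nonneg hN (sq_nonneg (s + 1))
  have hsq'' := sq_nonneg (N * s)
  constructor <;> linarith

theorem lipschitzWith_entropy (N : ℝ≥0) : LipschitzWith (N + 1) (entropy N) :=
  lipschitzWith_of_nnnorm_deriv_le
    (fun s => (hasDerivAt_entropy N.coe_nonneg s).differentiableAt) fun s => by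
      rw [(hasDerivAt_entropy N.coe_nonneg s).deriv, ← NNReal.coe_le_coe]
      exact abs_entropyDeriv_le N.coe_nonneg s

theorem abs_deriv_entropyDeriv_le (hN : 0 ≤ N) (s : ℝ) :
    |deriv (entropyDeriv N) s| ≤ 2 * N := by
  have hpos := one_add_mul_sq_pos hN s
  have hNs : 0 ≤ N * s ^ 2 := by positivity
  rw [deriv_entropyDeriv hN, abs_div, abs_of_pos (pow_pos hpos 2), div_le_iff₀ (pow_pos hpos 2),
    abs_mul, abs_of_nonneg (by positivity)]
  gcongr
  rw [abs_le]
  constructor <;> nlinarith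

theorem entropyDeriv_nonneg (hN : 0 ≤ N) (hs : 0 ≤ s) : 0 ≤ entropyDeriv N s := by
  rw [entropyDeriv]
  positivity

theorem mul_entropyDeriv_le (hN : 0 ≤ N) (s : ℝ) : s * entropyDeriv N s ≤ 2 := by
  have hpos := one_add_mul_sq_pos hN s
  rw [entropyDeriv, ← mul_div_assoc, div_le_iff₀ hpos]
  linarith

theorem neg_entropyDeriv_le (hN : 0 ≤ N) (hs : 0 ≤ s) :
    -entropyDeriv N s ≤ s * deriv (entropyDeriv N) s := by
  have hne := (one_add_mul_sq_pos hN s).ne'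
  have hsum : entropyDeriv N s + s * deriv (entropyDeriv N) s =
      4 * N * s / (1 + N * s ^ 2) ^ 2 := by
    rw [deriv_entropyDeriv hN, entropyDeriv]
    field_simp [hne]
    ring
  have hnonneg : 0 ≤ 4 * N * s / (1 + N * s ^ 2) ^ 2 := by positivity
  linarith

end Entropy

/-! ### The energy inequality -/

section Energy

variable {Ω : Set (E n)} {p v b η : E n → ℝ} {g A : E n → E n} {φ : ℕ → E n → ℝ} {ψ : ℝ → ℝ}

theorem IsTest.mul_comp {ξ : E n → ℝ} (hη : IsTest ∞ Ω η) (hψ : ContDiff ℝ ∞ ψ)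
    (hξ : IsTest ∞ Ω ξ) : IsTest ∞ Ω fun x => η x * ψ (ξ x) :=
  ⟨hη.1.mul (hψ.comp hξ.1), hη.2.1.mul_right, tsupport_mul_subset_left.trans hη.2.2⟩

theorem IsWeakDivergence.integral_mul_comp_isTest {ξ : E n → ℝ} (h : IsWeakDivergence Ω A b)
    (hη : IsTest ∞ Ω η) (hψ : ContDiff ℝ ∞ ψ) (hξ : IsTest ∞ Ω ξ) :
    ∫ x in Ω, (ψ (ξ x) * (b x * η x + inner ℝ (A x) (gradient η x)) +
      η x * deriv ψ (ξ x) * inner ℝ (A x) (gradient ξ x)) = 0 := by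
  refine (integral_congr_ae (Eventually.of_forall fun x => ?_)).trans (h _ (hη.mul_comp hψ hξ))
  have hξd : DifferentiableAt ℝ ξ x := hξ.1.differentiable (by simp) x
  have hψd : DifferentiableAt ℝ ψ (ξ x) := hψ.differentiable (by simp) _
  have hcomp : DifferentiableAt ℝ (fun y => ψ (ξ y)) x := hψd.comp x hξd
  simp only [gradient_mul (hη.1.differentiable (by simp) x) hcomp, gradient_comp hψd hξd,
    inner_add_right, inner_smul_right]
  ring

variable {C C' : ℝ}

theorem IsTest.integrableOn_comp_mul_add (hη : IsTest 1 Ω η)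
    (hv : AEStronglyMeasurable v (volume.restrict Ω)) (hb : IntegrableOn b Ω)
    (hA : IntegrableOn A Ω) (hψ : Continuous ψ) (hC : ∀ s, |ψ s| ≤ C) :
    IntegrableOn (fun x => ψ (v x) * (b x * η x + inner ℝ (A x) (gradient η x))) Ω :=
  (hη.integrable_mul_add_inner_gradient measurable_id hb hA).bdd_mul (c := C)
    (hψ.comp_aestronglyMeasurable hv) (Eventually.of_forall fun _ => hC _)

theorem IsTest.integrableOn_mul_comp_mul {k : WithTop ℕ∞} {f : E n → ℝ} (hη : IsTest k Ω η)
    (hv : AEStronglyMeasurable v (volume.restrict Ω)) (hf : IntegrableOn f Ω) (hψ : Continuous ψ)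
    (hC : ∀ s, |ψ s| ≤ C) : IntegrableOn (fun x => η x * ψ (v x) * f x) Ω := by
  obtain ⟨Cη, hCη⟩ := hη.exists_bound
  refine hf.bdd_mul (c := Cη * C) (hη.1.continuous.aestronglyMeasurable.mul
    (hψ.comp_aestronglyMeasurable hv)) (Eventually.of_forall fun x => ?_)
  rw [norm_mul]
  exact mul_le_mul (hCη x) (hC _) (norm_nonneg _) ((abs_nonneg _).trans (hCη x))

theorem IsWeakDivergence.integral_mul_comp (h : IsWeakDivergence Ω A b)
    (hφ : IsTestApprox Ω p v g φ) (hb : IntegrableOn b Ω) (hA : IntegrableOn A Ω)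
    (hAg : IntegrableOn (fun x => inner ℝ (A x) (g x)) Ω)
    (hlim : Tendsto (fun k => ∫⁻ x in Ω, ‖inner ℝ (A x) (gradient (φ k) x - g x)‖ₑ) atTop (𝓝 0))
    (hη : IsTest ∞ Ω η) (hψ : ContDiff ℝ ∞ ψ) (hC : ∀ s, |ψ s| ≤ C) (hC' : ∀ s, |deriv ψ s| ≤ C') :
    ∫ x in Ω, (ψ (v x) * (b x * η x + inner ℝ (A x) (gradient η x)) +
      η x * deriv ψ (v x) * inner ℝ (A x) (g x)) = 0 := by
  obtain ⟨Cη, hCη⟩ := hη.exists_bound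
  have hψ' : Continuous (deriv ψ) := hψ.continuous_deriv (by simp)
  have hη₁ : IsTest 1 Ω η := hη.of_le (by simp)
  have hφ₁ : ∀ k, IsTest 1 Ω (φ k) := fun k => (hφ.isTest k).of_le (by simp)
  have hφm : ∀ k, AEStronglyMeasurable (φ k) (volume.restrict Ω) := fun k =>
    (hφ₁ k).1.continuous.aestronglyMeasurable
  have hAφ : ∀ k, IntegrableOn (fun x => inner ℝ (A x) (gradient (φ k) x)) Ω := fun k => by
    obtain ⟨D, hD⟩ := (hφ₁ k).exists_gradient_bound
    exact integrable_inner_of_bounded hA (continuous_gradient (hφ₁ k).1).aestronglyMeasurable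
      (Eventually.of_forall hD)
  have hint := hη₁.integrable_mul_add_inner_gradient measurable_id hb hA
  have hlim₁ := hφ.tendsto_setIntegral_smul (a := fun s _ => ψ s)
    (hψ.continuous.comp continuous_fst) (fun s _ => hC s) (fun _ => hint.1) hint (by simp)
  have hlim₂ := hφ.tendsto_setIntegral_smul (a := fun s x => η x * deriv ψ s)
    ((hη.1.continuous.comp continuous_snd).mul (hψ'.comp continuous_fst))
    (fun s x => abs_mul (η x) (deriv ψ s) ▸
      mul_le_mul (hCη x) (hC' s) (abs_nonneg _) ((abs_nonneg _).trans (hCη x)))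
    (fun k => (hAφ k).1) hAg (by simpa only [inner_sub_right] using hlim)
  have hsplit : ∀ {ξ : E n → ℝ} {f : E n → ℝ}, AEStronglyMeasurable ξ (volume.restrict Ω) →
      IntegrableOn f Ω →
      ∫ x in Ω, (ψ (ξ x) * (b x * η x + inner ℝ (A x) (gradient η x)) +
        η x * deriv ψ (ξ x) * f x) =
      (∫ x in Ω, ψ (ξ x) * (b x * η x + inner ℝ (A x) (gradient η x))) +
        ∫ x in Ω, η x * deriv ψ (ξ x) * f x := fun hξ hf => integral_add
    (hη₁.integrableOn_comp_mul_add hξ hb hA hψ.continuous hC)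
    (hη.integrableOn_mul_comp_mul hξ hf hψ' hC')
  rw [hsplit hφ.aestronglyMeasurable hAg]
  refine tendsto_nhds_unique (hlim₁.add hlim₂) (tendsto_const_nhds.congr fun k => ?_)
  rw [← h.integral_mul_comp_isTest hη hψ (hφ.isTest k), hsplit (hφm k) (hAφ k)]
  rfl

theorem IsTestApprox.tendsto_lintegral_smul_pFlux {a : E n → ℝ} (h : IsTestApprox Ω p v g φ)
    (ha : ∀ᵐ x ∂(volume.restrict Ω), |a x| ≤ C) :
    Tendsto (fun k => ∫⁻ x in Ω, ‖inner ℝ (a x • pFlux (p x) (g x)) (gradient (φ k) x - g x)‖ₑ)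
      atTop (𝓝 0) := by
  simpa only [real_inner_smul_left, smul_eq_mul] using
    tendsto_lintegral_enorm_smul_zero_of_bounded (fun _ => ha) h.tendsto_lintegral_flux

theorem energy_density_le {F : Type*} [NormedAddCommGroup F] [InnerProductSpace ℝ F]
    {m M N D q s e κ : ℝ} {a y : F} (hm : 1 ≤ m) (hN : 0 ≤ N) (hq : 1 ≤ q) (hs : s ∈ Icc 0 M)
    (he : 0 ≤ e) (hy : ‖y‖ ≤ D) :
    κ * (e * entropyDeriv N s) ≤
      entropyDeriv N s * ((κ + m * s ^ (m - 1) * ‖a‖ ^ q) * e + inner ℝ (s ^ m • pFlux q a) y) +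
        e * deriv (entropyDeriv N) s * (s ^ m * ‖a‖ ^ q) +
      2 * M ^ (m - 1) * D * (1 + ‖a‖ ^ q) := by
  have hs₀ : 0 ≤ s := hs.1
  have hpow : s ^ m = s ^ (m - 1) * s := by
    rw [← Real.rpow_add_one' hs₀ (by linarith), sub_add_cancel]
  have hboundary : entropyDeriv N s * -inner ℝ (s ^ m • pFlux q a) y ≤
      2 * M ^ (m - 1) * D * (1 + ‖a‖ ^ q) := by
    have hinner : -inner ℝ (pFlux q a) y ≤ (1 + ‖a‖ ^ q) * D :=
      (neg_le_abs _).trans ((abs_real_inner_le_norm _ _).trans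
        (mul_le_mul (norm_pFlux_le_one_add hq a) hy (norm_nonneg _) (by positivity)))
    have hD : 0 ≤ D := (norm_nonneg y).trans hy
    calc entropyDeriv N s * -inner ℝ (s ^ m • pFlux q a) y
        = s * entropyDeriv N s * s ^ (m - 1) * -inner ℝ (pFlux q a) y := by
          rw [real_inner_smul_left, hpow]
          ring
      _ ≤ s * entropyDeriv N s * s ^ (m - 1) * ((1 + ‖a‖ ^ q) * D) := by
          have := entropyDeriv_nonneg hN hs₀
          gcongr
      _ ≤ 2 * M ^ (m - 1) * ((1 + ‖a‖ ^ q) * D) := by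
          gcongr
          · exact mul_entropyDeriv_le hN s
          · exact hs.2
      _ = 2 * M ^ (m - 1) * D * (1 + ‖a‖ ^ q) := by ring
  have hinterior : 0 ≤ e * (s ^ (m - 1) * ‖a‖ ^ q) *
      (m * entropyDeriv N s + s * deriv (entropyDeriv N) s) := by
    have hψ := entropyDeriv_nonneg hN hs₀
    have hψ' := neg_entropyDeriv_le hN hs₀
    have hsum : 0 ≤ m * entropyDeriv N s + s * deriv (entropyDeriv N) s := by nlinarith
    positivity
  rw [hpow] at hboundary ⊢
  linarith

theorem MemVZero.integrableOn_and_integral_mul_comp [IsFiniteMeasure (volume.restrict Ω)]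
    {m M : ℝ} (h : MemVZero Ω p v g) (hpm : AEMeasurable p (volume.restrict Ω))
    (hp : ∀ᵐ x ∂(volume.restrict Ω), 1 ≤ p x) (hm : 0 ≤ m)
    (hv : ∀ᵐ x ∂(volume.restrict Ω), v x ∈ Icc 0 M) (hb : IntegrableOn b Ω)
    (heq : IsWeakDivergence Ω (fun x => v x ^ m • pFlux (p x) (g x)) b)
    (hη : IsTest ∞ Ω η) (hψ : ContDiff ℝ ∞ ψ) (hC : ∀ s, |ψ s| ≤ C) (hC' : ∀ s, |deriv ψ s| ≤ C') :
    let f := fun x =>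
      ψ (v x) * (b x * η x + inner ℝ (v x ^ m • pFlux (p x) (g x)) (gradient η x)) +
        η x * deriv ψ (v x) * (v x ^ m * ‖g x‖ ^ p x)
    IntegrableOn f Ω ∧ ∫ x in Ω, f x = 0 := by
  obtain ⟨φ, hφ⟩ := h.exists_isTestApprox hp
  have hvm := h.1.aestronglyMeasurable
  have hA : IntegrableOn (fun x => v x ^ m • pFlux (p x) (g x)) Ω :=
    integrable_rpow_smul hm hvm.aemeasurable hv
      (integrable_pFlux hpm hp h.1.aestronglyMeasurable_gradient h.1.2.2)
  have henergy : IntegrableOn (fun x => v x ^ m * ‖g x‖ ^ p x) Ω :=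
    integrable_rpow_smul hm hvm.aemeasurable hv h.1.2.2
  have hAg : (fun x => inner ℝ (v x ^ m • pFlux (p x) (g x)) (g x)) =ᵐ[volume.restrict Ω]
      fun x => v x ^ m * ‖g x‖ ^ p x := hp.mono fun x hx => by
    simp only [real_inner_smul_left, inner_pFlux_self (zero_lt_one.trans_le hx).ne']
  refine ⟨((hη.of_le (by simp)).integrableOn_comp_mul_add hvm hb hA hψ.continuous hC).add
    (hη.integrableOn_mul_comp_mul hvm henergy (hψ.continuous_deriv (by simp)) hC'), ?_⟩
  have hbound : ∀ᵐ x ∂(volume.restrict Ω), |v x ^ m| ≤ M ^ m := hv.mono fun x hx =>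
    (abs_of_nonneg (Real.rpow_nonneg hx.1 m)).trans_le (Real.rpow_le_rpow hx.1 hx.2 hm)
  rw [← heq.integral_mul_comp hφ hb hA (henergy.congr hAg.symm)
    (hφ.tendsto_lintegral_smul_pFlux hbound) hη hψ hC hC']
  exact integral_congr_ae (hAg.mono fun x hx => by simp only [hx])

theorem MemVZero.integral_mul_entropyDeriv_le [IsFiniteMeasure (volume.restrict Ω)]
    {κ : E n → ℝ} {m M D N : ℝ} (h : MemVZero Ω p v g) (hpm : AEMeasurable p (volume.restrict Ω))
    (hp : ∀ᵐ x ∂(volume.restrict Ω), 1 ≤ p x) (hm : 1 ≤ m)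
    (hv : ∀ᵐ x ∂(volume.restrict Ω), v x ∈ Icc 0 M) (hκ : IntegrableOn κ Ω)
    (heq : IsWeakDivergence Ω (fun x => v x ^ m • pFlux (p x) (g x))
      fun x => κ x + m * v x ^ (m - 1) * ‖g x‖ ^ p x)
    (hη : IsTest ∞ Ω η) (hη₀ : ∀ x, 0 ≤ η x) (hD : ∀ x, ‖gradient η x‖ ≤ D) (hN : 0 ≤ N) :
    ∫ x in Ω, κ x * (η x * entropyDeriv N (v x)) ≤
      2 * M ^ (m - 1) * D * ∫ x in Ω, (1 + ‖g x‖ ^ p x) := by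
  have hvm := h.1.aestronglyMeasurable
  have hgi : IntegrableOn (fun x => ‖g x‖ ^ p x) Ω := h.1.2.2
  have hψ := contDiff_entropyDeriv hN
  have hsource : IntegrableOn (fun x => m * v x ^ (m - 1) * ‖g x‖ ^ p x) Ω := by
    simpa only [smul_eq_mul, mul_assoc, IntegrableOn] using
      (integrable_rpow_smul (sub_nonneg.2 hm) hvm.aemeasurable hv hgi).const_mul m
  obtain ⟨htest_int, htest⟩ := h.integrableOn_and_integral_mul_comp hpm hp (zero_le_one.trans hm) hv
    (hκ.add hsource) heq hη hψ (abs_entropyDeriv_le hN) (abs_deriv_entropyDeriv_le hN)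
  have hmain : IntegrableOn (fun x => κ x * (η x * entropyDeriv N (v x))) Ω := by
    simpa only [mul_comm (κ _)] using
      hη.integrableOn_mul_comp_mul hvm hκ hψ.continuous (abs_entropyDeriv_le hN)
  have hbound : IntegrableOn (fun x => 2 * M ^ (m - 1) * D * (1 + ‖g x‖ ^ p x)) Ω :=
    ((integrable_const (1 : ℝ)).add hgi).const_mul _
  rw [← integral_const_mul, ← zero_add (∫ x in Ω, 2 * M ^ (m - 1) * D * _), ← htest,
    ← integral_add htest_int hbound]
  refine integral_mono_ae hmain (htest_int.add hbound) ?_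
  filter_upwards [hv, hp] with x hvx hpx using energy_density_le hm hN hpx hvx (hη₀ x) (hD x)

end Energy

/-! ### Primitives in time -/

section Time

variable {X : Type*} [MeasurableSpace X] {μ : Measure X} {T t : ℝ} {w : X × ℝ → ℝ}

theorem integrable_prod_Ioo_mono {F : Type*} [NormedAddCommGroup F] {f : X × ℝ → F}
    (hf : Integrable f (μ.prod (volume.restrict (Ioo 0 T)))) (ht : t ≤ T) :
    Integrable f (μ.prod (volume.restrict (Ioo 0 t))) :=
  hf.mono_measure (Measure.prod_mono le_rfl
    (Measure.restrict_mono (Ioo_subset_Ioo_right ht) le_rfl))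

theorem intervalIntegral_eq_integral_Ioo {F : Type*} [NormedAddCommGroup F] [NormedSpace ℝ F]
    (ht : 0 ≤ t) (f : ℝ → F) : ∫ r in 0..t, f r = ∫ r in Ioo 0 t, f r := by
  rw [intervalIntegral.integral_of_le ht, integral_Ioc_eq_integral_Ioo]

theorem aestronglyMeasurable_primitive
    (hw : AEStronglyMeasurable w (μ.prod (volume.restrict (Ioo 0 T)))) :
    AEStronglyMeasurable (fun z : X × ℝ => ∫ r in 0..z.2, w (z.1, r))
      (μ.prod (volume.restrict (Ioo 0 T))) := by
  have hind : StronglyMeasurable (fun q : (X × ℝ) × ℝ =>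
      {q : (X × ℝ) × ℝ | 0 < q.2 ∧ q.2 < q.1.2}.indicator
        (fun q => hw.mk w (q.1.1, q.2)) q) :=
    (hw.stronglyMeasurable_mk.comp_measurable (by fun_prop)).indicator
      ((measurableSet_lt measurable_const measurable_snd).inter
        (measurableSet_lt measurable_snd (by fun_prop)))
  refine ⟨_, hind.integral_prod_right' (ν := volume), ?_⟩
  have hmk : ∀ᵐ z ∂(μ.prod ((volume : Measure ℝ).restrict (Ioo 0 T))),
      ∀ᵐ r ∂(volume.restrict (Ioo 0 T)), w (z.1, r) = hw.mk w (z.1, r) :=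
    Measure.quasiMeasurePreserving_fst.ae (Measure.ae_ae_of_ae_prod hw.ae_eq_mk)
  have hmem : ∀ᵐ z ∂(μ.prod ((volume : Measure ℝ).restrict (Ioo 0 T))), z.2 ∈ Ioo 0 T :=
    Measure.quasiMeasurePreserving_snd.ae (ae_restrict_mem measurableSet_Ioo)
  filter_upwards [hmk, hmem] with z hz hzT
  rw [intervalIntegral_eq_integral_Ioo hzT.1.le]
  exact (integral_congr_ae (ae_restrict_of_ae_restrict_of_subset
    (Ioo_subset_Ioo_right hzT.2.le) hz)).trans (integral_indicator measurableSet_Ioo).symm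

theorem ae_comp_sub_eq_integral [SFinite μ] {u : X × ℝ → ℝ} {u₀ : X → ℝ}
    (hw : Integrable w (μ.prod (volume.restrict (Ioo 0 T))))
    (hu : AEStronglyMeasurable u (μ.prod (volume.restrict (Ioo 0 T))))
    (hu₀ : AEStronglyMeasurable u₀ μ)
    (h : ∀ᵐ t ∂(volume.restrict (Ioo 0 T)), ∀ᵐ x ∂μ, u (x, t) = u₀ x + ∫ r in 0..t, w (x, r))
    {Ψ ψ : ℝ → ℝ} {K : ℝ≥0} (hΨ : ∀ s, HasDerivAt Ψ (ψ s) s) (hK : LipschitzWith K Ψ) :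
    ∀ᵐ t ∂(volume.restrict (Ioo 0 T)), ∀ᵐ x ∂μ,
      Ψ (u (x, t)) - Ψ (u₀ x) = ∫ s in Ioo 0 t, ψ (u (x, s)) * w (x, s) := by
  have hprim : u =ᵐ[μ.prod (volume.restrict (Ioo 0 T))]
      fun z => u₀ z.1 + ∫ r in 0..z.2, w (z.1, r) :=
    ae_eq_prod_of_ae_ae_swap hu (hu₀.comp_fst.add (aestronglyMeasurable_primitive hw.1)) h
  filter_upwards [h, ae_restrict_mem measurableSet_Ioo] with t ht htT
  filter_upwards [ht, Measure.ae_ae_of_ae_prod hprim, hw.prod_right_ae] with x hxt hxs hwx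
  have hwi : IntervalIntegrable (fun r => w (x, r)) volume 0 T :=
    (intervalIntegrable_iff_integrableOn_Ioo_of_le (htT.1.trans htT.2).le).2 hwx
  rw [hxt, comp_primitive_sub_eq_integral hwi ⟨htT.1.le, htT.2.le⟩ hΨ hK,
    intervalIntegral_eq_integral_Ioo htT.1.le]
  refine integral_congr_ae ?_
  filter_upwards [ae_restrict_of_ae_restrict_of_subset (Ioo_subset_Ioo_right htT.2.le) hxs]
    with s hs
  rw [hs]

theorem integral_prod_mul_mul {Y : Type*} [MeasurableSpace Y] {ν : Measure Y} [SFinite μ]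
    [SFinite ν] {f : X × Y → ℝ} {θ : X → ℝ} {χ : Y → ℝ}
    (h : Integrable (fun z => f z * (θ z.1 * χ z.2)) (μ.prod ν)) :
    ∫ z, f z * (θ z.1 * χ z.2) ∂(μ.prod ν) = ∫ y, (∫ x, θ x * f (x, y) ∂μ) * χ y ∂ν := by
  rw [integral_prod_symm _ h]
  refine integral_congr_ae (Eventually.of_forall fun y => ?_)
  simp only [← integral_mul_const]
  congr with x
  ring

theorem continuousOn_integral_mul_Lp {U : ℝ → Lp ℝ 2 μ} {S : Set ℝ} {θ : X → ℝ}
    (hU : ContinuousOn U S) (hθ : MemLp θ 2 μ) :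
    ContinuousOn (fun t => ∫ x, θ x * U t x ∂μ) S := by
  have hinner : ∀ t, inner ℝ (hθ.toLp θ) (U t) = ∫ x, θ x * U t x ∂μ := fun t => by
    rw [L2.inner_def]
    refine integral_congr_ae (hθ.coeFn_toLp.mono fun x hx => ?_)
    simp only [hx, RCLike.inner_apply, conj_trivial, mul_comm]
  simpa only [hinner] using ContinuousOn.inner (𝕜 := ℝ) (continuousOn_const (c := hθ.toLp θ)) hU

end Time

section TimeDeriv

variable {Ω : Set (E n)} {T : ℝ} {u₀ θ : E n → ℝ} {u w : E n × ℝ → ℝ} {χ : ℝ → ℝ}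

theorem ae_eq_of_forall_integral_mul_isTest {f g : E n → ℝ} (hΩ : IsOpen Ω)
    (hf : IntegrableOn f Ω) (hg : IntegrableOn g Ω)
    (h : ∀ θ, IsTest ∞ Ω θ → ∫ x in Ω, θ x * f x = ∫ x in Ω, θ x * g x) :
    f =ᵐ[volume.restrict Ω] g := by
  refine (ae_restrict_iff' hΩ.measurableSet).2 ?_
  suffices ∀ᵐ x, x ∈ Ω → f x - g x = 0 from this.mono fun x hx hxΩ => sub_eq_zero.1 (hx hxΩ)
  refine hΩ.ae_eq_zero_of_integral_contDiff_smul_eq_zero (hf.sub hg).locallyIntegrableOn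
    fun θ hθs hθc hθΩ => ?_
  have hθ : IsTest ∞ Ω θ := ⟨hθs, hθc, hθΩ⟩
  have hfg : ∫ x in Ω, f x * θ x = ∫ x in Ω, g x * θ x := by
    simpa only [mul_comm] using h θ hθ
  calc ∫ x, θ x • (f x - g x) = ∫ x in Ω, (f x - g x) * θ x := by
        rw [hθ.setIntegral_mul_eq_integral fun x => f x - g x]
        simp only [smul_eq_mul, mul_comm]
    _ = (∫ x in Ω, f x * θ x) - ∫ x in Ω, g x * θ x := by
        rw [← integral_sub (hθ.integrableOn_mul hf) (hθ.integrableOn_mul hg)]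
        simp only [sub_mul]
    _ = 0 := sub_eq_zero.2 hfg

theorem integrable_mul_test_mul {f : E n × ℝ → ℝ} {k : WithTop ℕ∞}
    (hf : Integrable f ((volume.restrict Ω).prod (volume.restrict (Ioo 0 T))))
    (hθ : IsTest k Ω θ) (hχ : Continuous χ) (hχc : HasCompactSupport χ) :
    Integrable (fun z => f z * (θ z.1 * χ z.2))
      ((volume.restrict Ω).prod (volume.restrict (Ioo 0 T))) := by
  obtain ⟨C, hC⟩ := hθ.exists_bound
  obtain ⟨D, hD⟩ := hχc.exists_bound_of_continuous hχ
  refine hf.mul_bdd (c := C * D) ((hθ.1.continuous.comp continuous_fst).mul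
    (hχ.comp continuous_snd)).aestronglyMeasurable (Eventually.of_forall fun z => ?_)
  rw [norm_mul]
  exact mul_le_mul (hC z.1) (hD z.2) (norm_nonneg _) ((abs_nonneg _).trans (hC z.1))

theorem IsWeakTimeDeriv.integral_slice_mul_deriv (h : IsWeakTimeDeriv Ω T u w)
    (hu : Integrable u ((volume.restrict Ω).prod (volume.restrict (Ioo 0 T))))
    (hw : Integrable w ((volume.restrict Ω).prod (volume.restrict (Ioo 0 T))))
    (hθ : IsTest ∞ Ω θ) (hχ : IsTest ∞ (Ioo 0 T) χ) :
    ∫ t in Ioo 0 T, (∫ x in Ω, θ x * u (x, t)) * deriv χ t =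
      -∫ t in Ioo 0 T, (∫ x in Ω, θ x * w (x, t)) * χ t := by
  have hχd : Differentiable ℝ χ := hχ.1.differentiable (by simp)
  have hweak := h.2.2 _ (hθ.mul_time hχ)
  simp only [deriv_const_mul _ (hχd _)] at hweak
  rwa [restrict_cylinder, integral_prod_mul_mul (integrable_mul_test_mul hu hθ
      (hχ.1.continuous_deriv (by simp)) hχ.2.1.deriv),
    integral_prod_mul_mul (integrable_mul_test_mul hw hθ hχ.1.continuous hχ.2.1)] at hweak

theorem IsWeakTimeDeriv.integral_mul_eq_add {U : ℝ → Lp ℝ 2 (volume.restrict Ω)} (hT : 0 < T)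
    (h : IsWeakTimeDeriv Ω T u w)
    (hu : Integrable u ((volume.restrict Ω).prod (volume.restrict (Ioo 0 T))))
    (hw : Integrable w ((volume.restrict Ω).prod (volume.restrict (Ioo 0 T))))
    (hU : ContinuousOn U (Icc 0 T))
    (hUu : ∀ᵐ t ∂(volume.restrict (Ioo 0 T)), U t =ᵐ[volume.restrict Ω] fun x => u (x, t))
    (hθ : IsTest ∞ Ω θ) {t : ℝ} (ht : t ∈ Icc 0 T) :
    ∫ x in Ω, θ x * U t x =
      (∫ x in Ω, θ x * U 0 x) + ∫ x in Ω, θ x * ∫ r in 0..t, w (x, r) := by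
  obtain ⟨C, hC⟩ := hθ.exists_bound
  have hθ₂ : MemLp θ 2 (volume.restrict Ω) :=
    (hθ.1.continuous.memLp_of_hasCompactSupport hθ.2.1).restrict Ω
  have hwθ : Integrable (fun z : E n × ℝ => θ z.1 * w z)
      ((volume.restrict Ω).prod (volume.restrict (Ioo 0 T))) :=
    hw.bdd_mul (c := C) (hθ.1.continuous.comp continuous_fst).aestronglyMeasurable
      (Eventually.of_forall fun z => hC z.1)
  have hslice : ∀ᵐ s ∂(volume.restrict (Ioo 0 T)),
      ∫ x in Ω, θ x * U s x = ∫ x in Ω, θ x * u (x, s) :=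
    hUu.mono fun s hs => integral_congr_ae (hs.mono fun x hx => by simp only [hx])
  rw [eq_add_integral_of_weakDeriv hT (continuousOn_integral_mul_Lp hU hθ₂)
    ((intervalIntegrable_iff_integrableOn_Ioo_of_le hT.le).2 hwθ.integral_prod_right)
    (fun χ hχ => (integral_congr_ae (hslice.mono fun s hs => by simp only [hs])).trans
      (h.integral_slice_mul_deriv hu hw hθ hχ)) t ht]
  simp only [intervalIntegral_eq_integral_Ioo ht.1, ← integral_const_mul]
  rw [integral_integral_swap (f := fun s x => θ x * w (x, s))
    (integrable_prod_Ioo_mono hwθ ht.2).swap]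

theorem IsWeakTimeDeriv.ae_eq_add_integral [IsFiniteMeasure (volume.restrict Ω)] (hΩ : IsOpen Ω)
    (hT : 0 < T) (h : IsWeakTimeDeriv Ω T u w)
    (hu : Integrable u ((volume.restrict Ω).prod (volume.restrict (Ioo 0 T))))
    (hw : Integrable w ((volume.restrict Ω).prod (volume.restrict (Ioo 0 T))))
    (h₀ : HasInitialTrace Ω T u u₀) :
    ∀ᵐ t ∂(volume.restrict (Ioo 0 T)), ∀ᵐ x ∂(volume.restrict Ω),
      u (x, t) = u₀ x + ∫ r in 0..t, w (x, r) := by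
  obtain ⟨U, hU, hUu, hU₀⟩ := h₀
  have hUi : ∀ t, IntegrableOn (U t) Ω := fun t => (Lp.memLp (U t)).integrable one_le_two
  filter_upwards [hUu, ae_restrict_mem measurableSet_Ioo] with t ht htT
  have htIcc : t ∈ Icc 0 T := Ioo_subset_Icc_self htT
  have hprim : IntegrableOn (fun x => ∫ r in 0..t, w (x, r)) Ω := by
    simp only [intervalIntegral_eq_integral_Ioo htIcc.1]
    exact (integrable_prod_Ioo_mono hw htIcc.2).integral_prod_left
  have hUt : U t =ᵐ[volume.restrict Ω] fun x => U 0 x + ∫ r in 0..t, w (x, r) := by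
    refine ae_eq_of_forall_integral_mul_isTest hΩ (hUi t) ((hUi 0).add hprim) fun θ hθ => ?_
    have hadd := integral_add (hθ.integrableOn_mul (hUi 0)) (hθ.integrableOn_mul hprim)
    simp only [mul_comm _ (θ _)] at hadd
    simp only [h.integral_mul_eq_add hT hu hw hU hUu hθ htIcc, mul_add, hadd]
  filter_upwards [ht, hUt, hU₀] with x hx hxt hx₀
  rw [← hx, hxt, hx₀]

end TimeDeriv

/-! ### Propagation of the zero set -/

section Vanishing

theorem integral_integral_Ioo_le {X : Type*} [MeasurableSpace X] {μ : Measure X} [SFinite μ]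
    {T t : ℝ} {f : X × ℝ → ℝ} {g : ℝ → ℝ}
    (hf : Integrable f (μ.prod (volume.restrict (Ioo 0 T)))) (hg : IntegrableOn g (Ioo 0 T))
    (hg₀ : ∀ s, 0 ≤ g s) (hfg : ∀ᵐ s ∂(volume.restrict (Ioo 0 T)), ∫ x, f (x, s) ∂μ ≤ g s)
    (ht : t ≤ T) :
    ∫ x, (∫ s in Ioo 0 t, f (x, s)) ∂μ ≤ ∫ s in Ioo 0 T, g s := by
  have hft := integrable_prod_Ioo_mono hf ht
  have hsub : Ioo 0 t ⊆ Ioo 0 T := Ioo_subset_Ioo_right ht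
  calc ∫ x, (∫ s in Ioo 0 t, f (x, s)) ∂μ = ∫ s in Ioo 0 t, ∫ x, f (x, s) ∂μ :=
        integral_integral_swap (f := fun x s => f (x, s)) hft
    _ ≤ ∫ s in Ioo 0 t, g s := integral_mono_ae hft.integral_prod_right (hg.mono_set hsub)
        (ae_restrict_of_ae_restrict_of_subset hsub hfg)
    _ ≤ ∫ s in Ioo 0 T, g s :=
        setIntegral_mono_set hg (Eventually.of_forall hg₀) hsub.eventuallyLE

variable {Ω : Set (E n)} {T : ℝ} {p u₀ η : E n → ℝ} {m : ℝ} {u w : E n × ℝ → ℝ}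
  {G : E n × ℝ → E n}

theorem HasInitialTrace.aestronglyMeasurable (h : HasInitialTrace Ω T u u₀) :
    AEStronglyMeasurable u₀ (volume.restrict Ω) :=
  let ⟨U, _, _, hU⟩ := h
  (Lp.aestronglyMeasurable (U 0)).congr hU

namespace IsWeakSolutionWith

theorem integrable [IsFiniteMeasure (volume.restrict Ω)]
    (hu : IsWeakSolutionWith Ω T p m u₀ u G w) :
    Integrable u ((volume.restrict Ω).prod (volume.restrict (Ioo 0 T))) := by
  have hL := hu.memLinfty
  rw [restrict_cylinder] at hL
  exact hL.integrable le_top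

theorem ae_integral_mul_entropyDeriv_le [IsFiniteMeasure (volume.restrict Ω)] (hΩ : IsOpen Ω)
    (hΩb : Bornology.IsBounded Ω) (hpm : AEMeasurable p (volume.restrict Ω))
    (hp : ∀ᵐ x ∂(volume.restrict Ω), 1 ≤ p x) (hm : 1 ≤ m)
    (hu : IsWeakSolutionWith Ω T p m u₀ u G w) (hη : IsTest ∞ Ω η) (hη₀ : ∀ x, 0 ≤ η x) {M D : ℝ}
    (hM : ∀ᵐ z ∂((volume.restrict Ω).prod (volume.restrict (Ioo 0 T))), u z ∈ Icc 0 M)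
    (hD : ∀ x, ‖gradient η x‖ ≤ D) :
    ∀ᵐ s ∂(volume.restrict (Ioo 0 T)), ∀ N : ℕ,
      ∫ x in Ω, w (x, s) * (η x * entropyDeriv N (u (x, s))) ≤
        2 * M ^ (m - 1) * D * ∫ x in Ω, (1 + ‖G (x, s)‖ ^ p x) := by
  filter_upwards [hu.ae_isWeakDivergence hΩ hΩb hpm hp hm, hu.lateralTrace,
    ae_ae_swap_of_ae_prod hM, hu.integrable_timeDeriv.prod_left_ae] with s hdiv htrace hMs hws N
  exact htrace.integral_mul_entropyDeriv_le hpm hp hm hMs hws hdiv hη hη₀ hD N.cast_nonneg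

theorem integrable_mul_entropyDeriv [IsFiniteMeasure (volume.restrict Ω)]
    (hu : IsWeakSolutionWith Ω T p m u₀ u G w) (hη : IsTest ∞ Ω η) (N : ℕ) :
    Integrable (fun z => w z * (η z.1 * entropyDeriv N (u z)))
      ((volume.restrict Ω).prod (volume.restrict (Ioo 0 T))) := by
  obtain ⟨C, hC⟩ := hη.exists_bound
  refine hu.integrable_timeDeriv.mul_bdd (c := C * (N + 1))
    ((hη.1.continuous.comp continuous_fst).aestronglyMeasurable.mul
      ((contDiff_entropyDeriv N.cast_nonneg).continuous.comp_aestronglyMeasurable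
        hu.aemeasurable.aestronglyMeasurable)) (Eventually.of_forall fun z => ?_)
  rw [norm_mul]
  exact mul_le_mul (hC z.1) (abs_entropyDeriv_le N.cast_nonneg (u z)) (norm_nonneg _)
    ((abs_nonneg _).trans (hC z.1))

theorem ae_mul_entropy_eq_integral [IsFiniteMeasure (volume.restrict Ω)] (hΩ : IsOpen Ω)
    (hT : 0 < T) (hu : IsWeakSolutionWith Ω T p m u₀ u G w)
    (hηu : ∀ᵐ x ∂(volume.restrict Ω), η x = 0 ∨ u₀ x = 0) :
    ∀ᵐ t ∂(volume.restrict (Ioo 0 T)), ∀ N : ℕ,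
      (fun x => η x * entropy N (u (x, t))) =ᵐ[volume.restrict Ω]
        fun x => ∫ s in Ioo 0 t, w (x, s) * (η x * entropyDeriv N (u (x, s))) := by
  refine ae_all_iff.2 fun N => ?_
  filter_upwards [ae_comp_sub_eq_integral hu.integrable_timeDeriv hu.integrable.1
    hu.initialTrace.aestronglyMeasurable
    (hu.timeDeriv.ae_eq_add_integral hΩ hT hu.integrable hu.integrable_timeDeriv hu.initialTrace)
    (fun s => hasDerivAt_entropy N.cast_nonneg s) (lipschitzWith_entropy N)] with t ht
  filter_upwards [ht, hηu] with x hx hx₀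
  have hη₀ : η x * entropy N (u₀ x) = 0 := by
    rcases hx₀ with h | h <;> simp only [h, entropy_zero, mul_zero, zero_mul]
  calc η x * entropy N (u (x, t)) = η x * (entropy N (u (x, t)) - entropy N (u₀ x)) := by
        rw [mul_sub, hη₀, sub_zero]
    _ = ∫ s in Ioo 0 t, η x * (entropyDeriv N (u (x, s)) * w (x, s)) := by
        rw [integral_const_mul, ← hx]
    _ = _ := by simp only [mul_comm, mul_left_comm]

theorem exists_integral_mul_entropy_le [IsFiniteMeasure (volume.restrict Ω)] (hΩ : IsOpen Ω)
    (hΩb : Bornology.IsBounded Ω) (hT : 0 < T) (hpm : AEMeasurable p (volume.restrict Ω))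
    (hp : ∀ᵐ x ∂(volume.restrict Ω), 1 ≤ p x) (hm : 1 ≤ m)
    (hu : IsWeakSolutionWith Ω T p m u₀ u G w) (hη : IsTest ∞ Ω η) (hη₀ : ∀ x, 0 ≤ η x)
    (hηu : ∀ᵐ x ∂(volume.restrict Ω), η x = 0 ∨ u₀ x = 0) :
    ∃ K, ∀ᵐ t ∂(volume.restrict (Ioo 0 T)), ∀ N : ℕ,
      IntegrableOn (fun x => η x * entropy N (u (x, t))) Ω ∧
        ∫ x in Ω, η x * entropy N (u (x, t)) ≤ K := by
  obtain ⟨M, hM₀, hM⟩ := hu.exists_ae_mem_Icc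
  obtain ⟨D, hD⟩ := (hη.of_le (l := 1) (by simp)).exists_gradient_bound
  have hD₀ : 0 ≤ D := (norm_nonneg _).trans (hD 0)
  have : IsFiniteMeasure ((volume : Measure ℝ).restrict (Ioo 0 T)) :=
    isFiniteMeasure_restrict.2 measure_Ioo_lt_top.ne
  have hbound : IntegrableOn
      (fun s => 2 * M ^ (m - 1) * D * ∫ x in Ω, (1 + ‖G (x, s)‖ ^ p x)) (Ioo 0 T) :=
    (((integrable_const (1 : ℝ)).add hu.integrable_rpow_gradient).integral_prod_right).const_mul _
  refine ⟨∫ s in Ioo 0 T, 2 * M ^ (m - 1) * D * ∫ x in Ω, (1 + ‖G (x, s)‖ ^ p x), ?_⟩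
  filter_upwards [hu.ae_mul_entropy_eq_integral hΩ hT hηu, ae_restrict_mem measurableSet_Ioo]
    with t ht htT N
  have hint := hu.integrable_mul_entropyDeriv hη N
  refine ⟨(integrable_prod_Ioo_mono hint htT.2.le).integral_prod_left.congr (ht N).symm, ?_⟩
  rw [integral_congr_ae (ht N)]
  exact integral_integral_Ioo_le hint hbound (fun s => by positivity)
    ((hu.ae_integral_mul_entropyDeriv_le hΩ hΩb hpm hp hm hη hη₀ hM hD).mono fun s hs => hs N)
    htT.2.le

theorem ae_slice_eq_zero [IsFiniteMeasure (volume.restrict Ω)] (hΩ : IsOpen Ω)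
    (hΩb : Bornology.IsBounded Ω) (hT : 0 < T) (hpm : AEMeasurable p (volume.restrict Ω))
    (hp : ∀ᵐ x ∂(volume.restrict Ω), 1 ≤ p x) (hm : 1 ≤ m)
    (hu : IsWeakSolutionWith Ω T p m u₀ u G w) (hη : IsTest ∞ Ω η) (hη₀ : ∀ x, 0 ≤ η x)
    (hηu : ∀ᵐ x ∂(volume.restrict Ω), η x = 0 ∨ u₀ x = 0) :
    ∀ᵐ t ∂(volume.restrict (Ioo 0 T)), ∀ᵐ x ∂(volume.restrict Ω), 0 < η x → u (x, t) = 0 := by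
  obtain ⟨K, hK⟩ := hu.exists_integral_mul_entropy_le hΩ hΩb hT hpm hp hm hη hη₀ hηu
  filter_upwards [hK] with t ht
  filter_upwards [ae_not_tendsto_atTop_of_integral_le
    (fun N => Eventually.of_forall fun x => mul_nonneg (hη₀ x) (entropy_nonneg N.cast_nonneg _))
    (fun N => (ht N).1) fun N => (ht N).2] with x hx hηx
  by_contra hne
  exact hx ((tendsto_entropy_atTop hne).const_mul_atTop hηx)

theorem ae_slice_eq_zero_of_isOpen [IsFiniteMeasure (volume.restrict Ω)] (hΩ : IsOpen Ω)
    (hΩb : Bornology.IsBounded Ω) (hT : 0 < T) (hpm : AEMeasurable p (volume.restrict Ω))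
    (hp : ∀ᵐ x ∂(volume.restrict Ω), 1 ≤ p x) (hm : 1 ≤ m)
    (hu : IsWeakSolutionWith Ω T p m u₀ u G w) {W : Set (E n)} (hW : IsOpen W) (hWΩ : W ⊆ Ω)
    (hu₀ : ∀ᵐ x ∂(volume.restrict Ω), x ∈ W → u₀ x = 0) :
    ∀ᵐ t ∂(volume.restrict (Ioo 0 T)), ∀ᵐ x ∂(volume.restrict Ω), x ∈ W → u (x, t) = 0 := by
  obtain ⟨S, hS, htest, hcover⟩ := exists_countable_isTest_cover hW
  have hzero : ∀ᵐ t ∂(volume.restrict (Ioo 0 T)), ∀ η ∈ S, ∀ᵐ x ∂(volume.restrict Ω),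
      0 < η x → u (x, t) = 0 := (ae_ball_iff hS).2 fun η hη => by
    refine hu.ae_slice_eq_zero hΩ hΩb hT hpm hp hm ((htest η hη).1.mono hWΩ) (htest η hη).2 ?_
    filter_upwards [hu₀] with x hx
    by_cases hxW : x ∈ W
    exacts [Or.inr (hx hxW), Or.inl ((htest η hη).1.eq_zero hxW)]
  filter_upwards [hzero] with t ht
  filter_upwards [(ae_ball_iff hS).2 ht] with x hx hxW
  obtain ⟨η, hη, hηx⟩ := hcover x hxW
  exact hx η hη hηx

end IsWeakSolutionWith

end Vanishing

end PxParabolic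

theorem theorem2_general {n : ℕ} {Ω : Set (PxParabolic.E n)} (hΩ : IsOpen Ω)
    (hΩb : Bornology.IsBounded Ω) {T : ℝ} (hT : 0 < T) {p : PxParabolic.E n → ℝ}
    (hpm : AEMeasurable p (volume.restrict Ω)) (hp : ∀ᵐ x ∂(volume.restrict Ω), 1 < p x)
    {m : ℝ} (hm : 1 ≤ m) {u₀ : PxParabolic.E n → ℝ} (hu₀ : ∀ᵐ x ∂(volume.restrict Ω), 0 ≤ u₀ x)
    {u : PxParabolic.E n × ℝ → ℝ} (hu : PxParabolic.IsWeakSolution Ω T p m u₀ u) :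
    ∀ᵐ t ∂(volume.restrict (Ioc 0 T)),
      PxParabolic.supp Ω (fun x => u (x, t)) ⊆ PxParabolic.supp Ω u₀ := by
  obtain ⟨G, w, hu⟩ := hu
  have : IsFiniteMeasure (volume.restrict Ω) := isFiniteMeasure_restrict.2 hΩb.measure_lt_top.ne
  have hzero : ∀ᵐ x ∂(volume.restrict Ω), x ∈ Ω \ PxParabolic.supp Ω u₀ → u₀ x = 0 := by
    filter_upwards [hu₀, ae_restrict_of_ae (PxParabolic.ae_nonpos_of_notMem_supp Ω u₀)]
      with x hx₀ hx hxW using le_antisymm (hx hxW) hx₀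
  have hvanish := hu.ae_slice_eq_zero_of_isOpen hΩ hΩb hT hpm (hp.mono fun _ h => h.le) hm
    (PxParabolic.isOpen_diff_supp hΩ u₀) sdiff_subset hzero
  rw [← Measure.restrict_congr_set Ioo_ae_eq_Ioc]
  filter_upwards [hvanish] with t ht
  refine PxParabolic.supp_subset_supp_of_ae_nonpos hΩ ?_
  filter_upwards [(ae_restrict_iff' hΩ.measurableSet).1 ht] with x hx hxW
  exact (hx hxW.1 hxW).le

theorem theorem2 {n : ℕ} (Ω : Set (PxParabolic.E n)) (hΩ : PxParabolic.IsBoundedLipschitzDomain Ω)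
    (T : ℝ) (hT : 0 < T)
    (p : PxParabolic.E n → ℝ) (hp : PxParabolic.IsLogHolderExponent Ω p)
    (m : ℝ) (hm : 1 ≤ m)
    (u₀ : PxParabolic.E n → ℝ) (hu₀ : ∀ᵐ x ∂(volume.restrict Ω), 0 ≤ u₀ x)
    (hsupp : PxParabolic.supp Ω u₀ ⊂ Ω)
    (u : PxParabolic.E n × ℝ → ℝ) (hu : PxParabolic.IsWeakSolution Ω T p m u₀ u) :
    ∀ᵐ t ∂(volume.restrict (Ioc 0 T)),
      PxParabolic.supp Ω (fun x => u (x, t)) ⊆ PxParabolic.supp Ω u₀ :=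
  theorem2_general hΩ.isOpen hΩ.isBounded hT (hp.aemeasurable hΩ.isOpen.measurableSet)
    (hp.ae_one_lt hΩ.isOpen.measurableSet) hm hu₀ hu
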